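/- **Setting.** Let $\theta$ be a real antisymmetric $d\times d$ matrix and $e\in\mathbb{R}^d$ a unit vector with $\theta e=0$. Let $E_\theta(d)$ be the group of maps $g=(x,R):v\mapsto x+Rv$ with $x\in\mathbb{R}^d$, $R\in SO(d)$, $R\theta=\theta R$. Let $r_e x=x-2(e,x)e$, $\gamma_e(g)=r_e g r_e$, let $E^e_\theta(d)\subset E_\theta(d)$ be the subgroup of all $(x,R)$ fixed by $\gamma_e$ with $Re=e$ (the reduced Euclidean group of $e^\perp$), and let $\mathfrak m_\theta$ be the $(-1)$-eigenspace of the involution that $\gamma_e$ induces on the Lie algebra of $E_\theta(d)$. Put $\mathbb{R}^d_>=\{x:(e,x)>0\}$ and $C=\{x: x_0>1+\|x-x_0e\|\}$, where $x_0=(e,x)$. Let $O\mapsto\mathcal E(O)$ be a map from the bounded open subsets of $\mathbb{R}^d$ to unital $C^*$-subalgebras of a unital $C^*$-algebra $\mathcal E$ generated by them, with $\mathcal E(O_1)\subset\mathcal E(O_2)$ for $O_1\subset O_2$, and let $\alpha$ be an action of $E_\theta(d)$ on $\mathcal E$ by $*$-automorphisms with $\alpha_g(\mathcal E(O))=\mathcal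 E(gO)$. For any other $X\subset\mathbb{R}^d$, $\mathcal E(X)$ is the $C^*$-algebra generated by all $\mathcal E(O)$ with $O\subset X$ bounded and open; $\mathcal E_>=\mathcal E(\mathbb{R}^d_>)$. Let $\sigma$ be a continuous linear functional on $\mathcal E$ with $\sigma(1)=1$, $\sigma\circ\alpha_g=\sigma$ for all $g$, and $g\mapsto\sigma(A\alpha_g(B))$ continuous for all $A,B\in\mathcal E$; let $\iota_e$ be a $*$-automorphism of $\mathcal E$ with $\iota_e(\mathcal E(O))=\mathcal E(r_eO)$, $\iota_e\alpha_g\iota_e=\alpha_{\gamma_e(g)}$, $\sigma\circ\iota_e=\sigma$ and $\sigma(\iota_e(A^*)A)\ge0$ for all $A\in\mathcal E_>$. Let $\mathcal H$ be the Hilbert space obtained from $\mathcal E_>$ with the form $\langle A,B\rangle=\sigma(\iota_e(A^*)B)$ by dividing out null vectors and completing, and $A\mapsto[A]_\sigma$ the canonical map $\mathcal E_>\to\mathcal H$. For $g\in E_\theta(d)$ let $V(g)[A]_\sigma=[\alpha_g(A)]_\sigma$, with domain $\mathrm{dom}\,V(g)$ the span of all $[\mathcal E(O)]_\sigma$, where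 $O\subset\mathbb{R}^d_>$ is open with $gO\subset\mathbb{R}^d_>$ and $\gamma_e(g)^{-1}gO\subset\mathbb{R}^d_>$; this is well defined. Let $\mathcal D_0=[\mathcal E(C)]_\sigma$. **Proposition.** There is a neighborhood $\mathscr U\supset E^e_\theta(d)$ of the identity in $E_\theta(d)$ such that $gC\subset\mathbb{R}^d_>$ and $\gamma_e(g)^{-1}gC\subset\mathbb{R}^d_>$ for all $g\in\mathscr U$, and $\gamma_e(g_1)^{-1}g_1g_2C\subset\mathbb{R}^d_>$ whenever $g_1,g_2,g_1g_2\in\mathscr U$. For each such $\mathscr U$, the data $(\mathscr U,\mathcal D_0,V)$ form a virtual representation of $E_\theta(d)$, i.e.: a) $\mathcal D_0$ is dense in $\mathcal H$, and $\mathcal D_0\subset\mathrm{dom}\,V(g)$ for all $g\in\mathscr U$. b) If $g_1,g_2,g_1g_2\in\mathscr U$ and $\Psi\in\mathcal D_0$, then $V(g_2)\Psi\in\mathrm{dom}\,V(g_1)$ and $V(g_1)V(g_2)\Psi=V(g_1g_2)\Psi$. c) For $g\in E^e_\theta(d)$, the operator $V(g)$ extends to a unitary on $\mathcal H$. d) For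 $g=\exp\mathsf m\in\mathscr U$ with $\mathsf m\in\mathfrak m_\theta$, the operator $V(g)$ is hermitian: $\langle V(g)\psi,\varphi\rangle=\langle\psi,V(g)\varphi\rangle$ for all $\psi,\varphi\in\mathrm{dom}\,V(g)$. e) For $\Psi\in\mathcal D_0$, $V(g)\Psi\to\Psi$ in norm as $g\to1$ in $\mathscr U$. f) The translations in $e$-direction form a contraction semigroup: for $t\ge0$ the translation $g_t$ by $te$ has $\mathrm{dom}\,V(g_t)=[\mathcal E_>]_\sigma$, and there are a strongly continuous contraction semigroup $(T_t)_{t\ge0}$ on $\mathcal H$ and a positive self-adjoint operator $H$ with $T_t=e^{-tH}$ (that is, $-H$ is the infinitesimal generator of $T$) such that $V(g_t)=T_t$ on $\mathrm{dom}\,V(g_t)$ for all $t\ge0$. -/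

import Mathlib

open scoped InnerProductSpace ComplexOrder Topology NNReal

noncomputable section

namespace EuclideanNets

/-- Euclidean space `ℝ^d`. -/
abbrev Space (d : ℕ) : Type := EuclideanSpace ℝ (Fin d)

/-- The Euclidean group `E(d)` of all isometries `v ↦ x + R v`. -/
abbrev EuclideanGroup (d : ℕ) : Type := Space d ≃ᵃⁱ[ℝ] Space d

/-- The usual topology of `E(d)`, in the coordinates `(x, R) = (g 0, linear part of g)`. -/
instance (d : ℕ) : TopologicalSpace (EuclideanGroup d) :=
  TopologicalSpace.induced
    (fun g : EuclideanGroup d =>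
      (g 0, (g.linearIsometryEquiv.toContinuousLinearEquiv : Space d →L[ℝ] Space d)))
    inferInstance

/-- A noncommutativity matrix `θ`, real and antisymmetric, with a unit vector `e` in its kernel. -/
structure Frame (d : ℕ) where
  θ : Matrix (Fin d) (Fin d) ℝ
  e : Space d
  skew : θ.transpose = -θ
  norm_e : ‖e‖ = 1
  theta_e : Matrix.toEuclideanLin θ e = 0

namespace Frame

variable {d : ℕ} (F : Frame d)

/-- The linear map of `ℝ^d` given by `θ`. -/
abbrev thetaLin : Space d →ₗ[ℝ] Space d := Matrix.toEuclideanLin F.θ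

/-- The reflection `r_e`. -/
def r : Space d ≃ₗᵢ[ℝ] Space d := (ℝ ∙ F.e)ᗮ.reflection

theorem r_apply (x : Space d) : F.r x = x - (2 * ⟪F.e, x⟫_ℝ) • F.e := by
  rw [r, Submodule.reflection_orthogonal_apply, Submodule.reflection_singleton_apply, F.norm_e]
  simp only [RCLike.ofReal_real_eq_id, id, one_pow, div_one, two_smul, two_mul, add_smul]
  abel

theorem r_r (x : Space d) : F.r (F.r x) = x := by
  simp [r]

theorem inner_theta (x : Space d) : ⟪F.e, F.thetaLin x⟫_ℝ = 0 := by
  have h : F.thetaLin.adjoint = -F.thetaLin := by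
    rw [thetaLin, ← Matrix.toEuclideanLin_conjTranspose_eq_adjoint,
      Matrix.conjTranspose_eq_transpose_of_trivial, F.skew, map_neg]
  rw [← LinearMap.adjoint_inner_left, h, LinearMap.neg_apply, F.theta_e]
  simp

theorem r_theta (x : Space d) : F.r (F.thetaLin x) = F.thetaLin (F.r x) := by
  rw [r_apply, r_apply, inner_theta, map_sub, map_smul, F.theta_e]
  simp

/-- `r_e` as an element of `E(d)`. -/
def rIso : EuclideanGroup d := F.r.toAffineIsometryEquiv

/-- The reduced Euclidean group `E_θ(d)`: all `(x, R)` with `det R = 1` and `R θ = θ R`. -/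
def group : Subgroup (EuclideanGroup d) where
  carrier := {g | LinearMap.det (g.linearIsometryEquiv.toLinearEquiv : Space d →ₗ[ℝ] Space d) = 1 ∧
    ∀ x, g.linearIsometryEquiv (F.thetaLin x) = F.thetaLin (g.linearIsometryEquiv x)}
  one_mem' := by
    refine ⟨?_, fun x => rfl⟩
    exact LinearMap.det_id
  mul_mem' := by
    rintro a b ⟨ha, ha'⟩ ⟨hb, hb'⟩
    refine ⟨?_, fun x => ?_⟩
    · have : ((a * b).linearIsometryEquiv.toLinearEquiv : Space d →ₗ[ℝ] Space d) =
          (a.linearIsometryEquiv.toLinearEquiv : Space d →ₗ[ℝ] Space d) ∘ₗ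
            (b.linearIsometryEquiv.toLinearEquiv : Space d →ₗ[ℝ] Space d) := rfl
      rw [this, LinearMap.det_comp, ha, hb, one_mul]
    · change a.linearIsometryEquiv (b.linearIsometryEquiv (F.thetaLin x)) =
        F.thetaLin (a.linearIsometryEquiv (b.linearIsometryEquiv x))
      rw [hb', ha']
  inv_mem' := by
    rintro a ⟨ha, ha'⟩
    refine ⟨?_, fun x => ?_⟩
    · have h := LinearEquiv.det_symm_mul_det a.linearIsometryEquiv.toLinearEquiv
      rw [ha, mul_one] at h
      exact h
    · change a.linearIsometryEquiv.symm (F.thetaLin x) =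
        F.thetaLin (a.linearIsometryEquiv.symm x)
      rw [LinearIsometryEquiv.symm_apply_eq, ha', LinearIsometryEquiv.apply_symm_apply]

/-- The involution `γ_e(g) = r_e g r_e` of `E_θ(d)`, i.e. `(x, R) ↦ (r_e x, r_e R r_e)`. -/
def gamma (g : F.group) : F.group :=
  ⟨F.rIso * g.1 * F.rIso, by
    obtain ⟨g, hg, hg'⟩ := g
    refine ⟨?_, fun x => ?_⟩
    · have : ((F.rIso * g * F.rIso).linearIsometryEquiv.toLinearEquiv : Space d →ₗ[ℝ] Space d) =
          ((F.r.toLinearEquiv : Space d →ₗ[ℝ] Space d) ∘ₗ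
          (g.linearIsometryEquiv.toLinearEquiv : Space d →ₗ[ℝ] Space d)) ∘ₗ
            (F.r.toLinearEquiv : Space d →ₗ[ℝ] Space d) := rfl
      have h2 : (F.r.toLinearEquiv : Space d →ₗ[ℝ] Space d) ∘ₗ
          (F.r.toLinearEquiv : Space d →ₗ[ℝ] Space d) = LinearMap.id :=
        LinearMap.ext fun x => F.r_r x
      have h3 := congrArg LinearMap.det h2
      rw [LinearMap.det_comp, LinearMap.det_id] at h3
      rw [this, LinearMap.det_comp, LinearMap.det_comp, hg, mul_one, h3]
    · change F.r (g.linearIsometryEquiv (F.r (F.thetaLin x))) =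
        F.thetaLin (F.r (g.linearIsometryEquiv (F.r x)))
      rw [r_theta, hg', r_theta]⟩

/-- The image `g X` of a set `X ⊆ ℝ^d`. -/
def act (g : F.group) (X : Set (Space d)) : Set (Space d) := (fun v => g.1 v) '' X

/-- The spatial subgroup `E_θ^e(d) ≅ E_ϑ(d-1)`: the `γ_e`-invariant `(x, R)` with `R e = e`. -/
def spatial : Set F.group := {g | F.gamma g = g ∧ g.1.linearIsometryEquiv F.e = F.e}

/-- The translation `exp (t p₀)` by `t e`. -/
def timeTranslation (t : ℝ) : F.group :=
  ⟨AffineIsometryEquiv.constVAdd ℝ (Space d) (t • F.e), by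
    refine ⟨?_, fun x => rfl⟩
    exact LinearMap.det_id⟩

/-- The Lie algebra of `E_θ(d)`: pairs `(a, X)`, `a ∈ ℝ^d`, with `X` antisymmetric and commuting
with `θ`. -/
def lieAlgebra : Set (Space d × (Space d →L[ℝ] Space d)) :=
  {m | (∀ x y, ⟪m.2 x, y⟫_ℝ = -⟪x, m.2 y⟫_ℝ) ∧ ∀ x, m.2 (F.thetaLin x) = F.thetaLin (m.2 x)}

/-- `𝔪_θ`, the eigenspace of eigenvalue `-1` of the involution `(a, X) ↦ (r_e a, r_e X r_e)` that
`γ_e` induces on the Lie algebra. -/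
def mSpace : Set (Space d × (Space d →L[ℝ] Space d)) :=
  {m | m ∈ F.lieAlgebra ∧ F.r m.1 = -m.1 ∧ ∀ x, F.r (m.2 (F.r x)) = -m.2 x}

/-- The block matrix `(X a; 0 0)` of `(a, X)` on `ℝ^d × ℝ`. -/
def blockMatrix (m : Space d × (Space d →L[ℝ] Space d)) :
    (Space d × ℝ) →L[ℝ] (Space d × ℝ) :=
  (m.2.comp (ContinuousLinearMap.fst ℝ (Space d) ℝ) +
    (ContinuousLinearMap.snd ℝ (Space d) ℝ).smulRight m.1).prod 0

/-- `g = exp m`, where `E(d)` is embedded into the invertible operators of `ℝ^d × ℝ` through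
its action on the hyperplane `ℝ^d × {1}`. -/
def IsExp (m : Space d × (Space d →L[ℝ] Space d)) (g : F.group) : Prop :=
  ∀ v : Space d, NormedSpace.exp (blockMatrix m) (v, (1 : ℝ)) = (g.1 v, (1 : ℝ))

/-- The half space `ℝ^d_>`. -/
def halfSpace : Set (Space d) := {x | 0 < ⟪F.e, x⟫_ℝ}

/-- The cone `C = {x₀ > 1 + (x₁² + ⋯ + x_{d-1}²)^{1/2}}`, where `x₀ = (e, x)`. -/
def cone : Set (Space d) := {x | 1 + ‖x - ⟪F.e, x⟫_ℝ • F.e‖ < ⟪F.e, x⟫_ℝ}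

/-- The neighborhoods `𝒰` of the identity on which the virtual representation lives. -/
structure IsAdmissible (U : Set F.group) : Prop where
  mem_nhds : U ∈ 𝓝 (1 : F.group)
  spatial_subset : F.spatial ⊆ U
  act_cone : ∀ g ∈ U, F.act g F.cone ⊆ F.halfSpace
  act_cone_gamma : ∀ g ∈ U, F.act ((F.gamma g)⁻¹ * g) F.cone ⊆ F.halfSpace
  act_cone_mul : ∀ g₁ ∈ U, ∀ g₂ ∈ U, g₁ * g₂ ∈ U →
    F.act ((F.gamma g₁)⁻¹ * g₁ * g₂) F.cone ⊆ F.halfSpace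

end Frame

/-- The family `𝒪` of bounded open subsets of `ℝ^d`. -/
def Region (d : ℕ) : Type := {O : Set (Space d) // IsOpen O ∧ Bornology.IsBounded O}

/-- The region `g O`. -/
def Region.image {d : ℕ} (g : EuclideanGroup d) (O : Region d) : Region d :=
  ⟨(fun v => g v) '' O.1, g.toHomeomorph.isOpenMap _ O.2.1, by
    have h : LipschitzWith 1 (fun v => g v) := g.lipschitz
    exact h.isBounded_image O.2.2⟩

/-- An `E_θ(d)`-covariant net of C*-algebras on `ℝ^d`, with total algebra `𝓐`. -/
structure CovariantNet {d : ℕ} (F : Frame d) (𝓐 : Type*) [CStarAlgebra 𝓐] where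
  alg : Region d → StarSubalgebra ℂ 𝓐
  isClosed_alg : ∀ O, IsClosed (alg O : Set 𝓐)
  isotony : ∀ O₁ O₂ : Region d, O₁.1 ⊆ O₂.1 → alg O₁ ≤ alg O₂
  generates : (⨆ O, alg O).topologicalClosure = ⊤
  α : F.group →* (𝓐 ≃⋆ₐ[ℂ] 𝓐)
  covariance : ∀ (g : F.group) (O : Region d),
    α g '' (alg O : Set 𝓐) = (alg (O.image g.1) : Set 𝓐)

namespace CovariantNet

variable {d : ℕ} {F : Frame d} {𝓐 : Type*} [CStarAlgebra 𝓐] (N : CovariantNet F 𝓐)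

/-- `𝓔(X)` for an arbitrary `X ⊆ ℝ^d`: the C*-algebra generated by all `𝓔(O)`, `O ∈ 𝒪`,
`O ⊆ X`. -/
def algOn (X : Set (Space d)) : StarSubalgebra ℂ 𝓐 :=
  (⨆ O : {O : Region d // O.1 ⊆ X}, N.alg O.1).topologicalClosure

/-- `𝓔_> = 𝓔(ℝ^d_>)`. -/
abbrev pos : StarSubalgebra ℂ 𝓐 := N.algOn F.halfSpace

theorem algOn_mono {X Y : Set (Space d)} (h : X ⊆ Y) : N.algOn X ≤ N.algOn Y := by
  refine StarSubalgebra.topologicalClosure_mono (iSup_le fun O => ?_)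
  exact le_iSup (fun O : {O : Region d // O.1 ⊆ Y} => N.alg O.1) ⟨O.1, O.2.trans h⟩

theorem α_mem {X Y : Set (Space d)} (g : F.group) (h : F.act g X ⊆ Y) {A : 𝓐}
    (hA : A ∈ N.algOn X) : N.α g A ∈ N.algOn Y := by
  have hc : Continuous (N.α g) := (StarAlgEquiv.isometry (N.α g)).continuous
  have hcl : IsClosed ((N.algOn Y : Set 𝓐)) := StarSubalgebra.isClosed_topologicalClosure _
  have hsub : (⨆ O : {O : Region d // O.1 ⊆ X}, N.alg O.1) ≤
      (N.algOn Y).comap (N.α g : 𝓐 →⋆ₐ[ℂ] 𝓐) := by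
    refine iSup_le fun O B hB => ?_
    have h1 : N.α g B ∈ N.alg (O.1.image g.1) := by
      have : N.α g B ∈ (N.alg (O.1.image g.1) : Set 𝓐) := by
        rw [← N.covariance]; exact ⟨B, hB, rfl⟩
      exact this
    refine StarSubalgebra.le_topologicalClosure _ ?_
    refine le_iSup (fun O : {O : Region d // O.1 ⊆ Y} => N.alg O.1)
      ⟨O.1.image g.1, ?_⟩ h1
    exact (Set.image_mono O.2).trans h
  have hA' : A ∈ closure ((⨆ O : {O : Region d // O.1 ⊆ X}, N.alg O.1 : StarSubalgebra ℂ 𝓐) :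
      Set 𝓐) := hA
  exact closure_minimal (fun B hB => hsub hB) (hcl.preimage hc) hA'

/-- The elements on which `V(g)` is defined: the span of all `𝓔(O)`, where `O ⊆ ℝ^d_>` is an open
region such that `g O` and `γ_e(g)⁻¹ g O` still lie in `ℝ^d_>`. -/
def preDomain (g : F.group) : Submodule ℂ 𝓐 :=
  ⨆ O : {O : Set (Space d) // IsOpen O ∧ O ⊆ F.halfSpace ∧ F.act g O ⊆ F.halfSpace ∧
      F.act ((F.gamma g)⁻¹ * g) O ⊆ F.halfSpace},
    Subalgebra.toSubmodule (N.algOn O.1).toSubalgebra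

end CovariantNet

/-- A functional `σ` on the net which is reflection positive with respect to `e`, together with
the automorphism `ι_e` that represents the reflection `r_e`. -/
structure ReflectionPositiveFunctional {d : ℕ} {F : Frame d} {𝓐 : Type*} [CStarAlgebra 𝓐]
    (N : CovariantNet F 𝓐) where
  σ : 𝓐 →L[ℂ] ℂ
  normalized : σ 1 = 1
  continuous_σ : ∀ A B : 𝓐, Continuous fun g : F.group => σ (A * N.α g B)
  invariant : ∀ (g : F.group) (A : 𝓐), σ (N.α g A) = σ A
  ι : 𝓐 ≃⋆ₐ[ℂ] 𝓐
  ι_alg : ∀ O : Region d, ι '' (N.alg O : Set 𝓐) = (N.alg (O.image F.rIso) : Set 𝓐)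
  ι_α_ι : ∀ (g : F.group) (A : 𝓐), ι (N.α g (ι A)) = N.α (F.gamma g) A
  σ_ι : ∀ A : 𝓐, σ (ι A) = σ A
  positive : ∀ A ∈ N.pos, 0 ≤ σ (ι (star A) * A)

namespace ReflectionPositiveFunctional

variable {d : ℕ} {F : Frame d} {𝓐 : Type*} [CStarAlgebra 𝓐] {N : CovariantNet F 𝓐}
  (S : ReflectionPositiveFunctional N)

theorem form_symm {A B : 𝓐} (hA : A ∈ N.pos) (hB : B ∈ N.pos) :
    (starRingEnd ℂ) (S.σ (S.ι (star B) * A)) = S.σ (S.ι (star A) * B) := by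
  have h1 := S.positive (A + B) (add_mem hA hB)
  have h2 := S.positive (A + Complex.I • B) (add_mem hA (N.pos.smul_mem hB _))
  have hAA := S.positive A hA
  have hBB := S.positive B hB
  simp only [star_add, map_add, star_smul, map_smul, add_mul, mul_add, smul_mul_assoc,
    mul_smul_comm, smul_eq_mul, Complex.star_def, Complex.conj_I] at h1 h2
  rw [Complex.le_def] at h1 h2 hAA hBB
  have e1 := h1.2
  have e2 := h2.2
  have e3 := hAA.2
  have e4 := hBB.2
  simp at e1 e2 e3 e4
  apply Complex.ext <;> simp <;> linarith

set_option linter.unusedVariables false in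
/-- The vector space `𝓔_>`, as the carrier of the semi-definite scalar product `σ(ι_e(A*) B)`. -/
@[nolint unusedArguments]
def PreHilbert (S : ReflectionPositiveFunctional N) : Type _ := N.pos

instance : AddCommGroup S.PreHilbert := inferInstanceAs (AddCommGroup N.pos)
instance : Module ℂ S.PreHilbert := inferInstanceAs (Module ℂ N.pos)

/-- The identity map from `𝓔_>` to `PreHilbert`. -/
def toPre : N.pos ≃ₗ[ℂ] S.PreHilbert := LinearEquiv.refl ℂ _

/-- The sesquilinear form `A, B ↦ σ(ι_e(A*) B)` on `𝓔_>`. -/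
abbrev core : PreInnerProductSpace.Core ℂ S.PreHilbert where
  inner A B := S.σ (S.ι (star (S.toPre.symm A : 𝓐)) * (S.toPre.symm B : 𝓐))
  conj_inner_symm A B := S.form_symm (S.toPre.symm A).2 (S.toPre.symm B).2
  re_inner_nonneg A := (Complex.le_def.1 (S.positive _ (S.toPre.symm A).2)).1
  add_left A B C := by
    simp [add_mul]
  smul_left A B c := by
    simp

instance : SeminormedAddCommGroup S.PreHilbert :=
  InnerProductSpace.Core.toSeminormedAddCommGroup (c := S.core)
instance : InnerProductSpace ℂ S.PreHilbert := InnerProductSpace.ofCore S.core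

/-- The Hilbert space `𝓗^𝓜`: the Hausdorff completion of `𝓔_>` in the scalar product
`σ(ι_e(A*) B)`, which is the completion of the quotient of `𝓔_>` by the null space. -/
abbrev Hilbert : Type _ := UniformSpace.Completion S.PreHilbert

/-- The map `A ↦ [A]_σ` from `𝓔_>` to `𝓗^𝓜`. -/
def cls : N.pos →ₗ[ℂ] S.Hilbert :=
  (UniformSpace.Completion.toComplL : S.PreHilbert →L[ℂ] S.Hilbert).toLinearMap ∘ₗ
    S.toPre.toLinearMap

theorem inner_cls (A B : N.pos) :
    ⟪S.cls A, S.cls B⟫_ℂ = S.σ (S.ι (star (A : 𝓐)) * (B : 𝓐)) := by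
  change ⟪((S.toPre A : S.PreHilbert) : S.Hilbert), ((S.toPre B : S.PreHilbert) : S.Hilbert)⟫_ℂ = _
  rw [UniformSpace.Completion.inner_coe]
  rfl

/-- The dense subspace `𝓓 = [𝓔_>]_σ`. -/
def D : Submodule ℂ S.Hilbert := LinearMap.range S.cls

/-- The subspace `𝓓₀ = [𝓔(C)]_σ`. -/
def D₀ : Submodule ℂ S.Hilbert where
  carrier := {ψ | ∃ A : N.pos, (A : 𝓐) ∈ N.algOn F.cone ∧ S.cls A = ψ}
  zero_mem' := ⟨0, zero_mem _, map_zero _⟩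
  add_mem' := by
    rintro _ _ ⟨A, hA, rfl⟩ ⟨B, hB, rfl⟩
    exact ⟨A + B, add_mem hA hB, map_add _ _ _⟩
  smul_mem' := by
    rintro c _ ⟨A, hA, rfl⟩
    exact ⟨c • A, (N.algOn F.cone).smul_mem hA c, map_smul _ _ _⟩

/-- The graph `{([A]_σ, [α_g(A)]_σ)}` of `V(g)`, where `A` runs through the elements on which
`V(g)` is defined. -/
def graph (g : F.group) : Submodule ℂ (S.Hilbert × S.Hilbert) where
  carrier := {p | ∃ A B : N.pos, (A : 𝓐) ∈ N.preDomain g ∧ (B : 𝓐) = N.α g A ∧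
    p = (S.cls A, S.cls B)}
  zero_mem' := ⟨0, 0, zero_mem _, by simp, by rw [map_zero]; rfl⟩
  add_mem' := by
    rintro _ _ ⟨A, B, hA, hB, rfl⟩ ⟨A', B', hA', hB', rfl⟩
    exact ⟨A + A', B + B', add_mem hA hA', by simp [hB, hB'], by simp⟩
  smul_mem' := by
    rintro c _ ⟨A, B, hA, hB, rfl⟩
    exact ⟨c • A, c • B, (N.preDomain g).smul_mem c hA, by simp [hB], by simp⟩

/-- The operator `V(g)[A]_σ = [α_g(A)]_σ`. -/
def V (g : F.group) : S.Hilbert →ₗ.[ℂ] S.Hilbert := (S.graph g).toLinearPMap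

theorem mem_of_preDomain (g h : F.group)
    (hh : ∀ O : Set (Space d), O ⊆ F.halfSpace → F.act g O ⊆ F.halfSpace →
      F.act ((F.gamma g)⁻¹ * g) O ⊆ F.halfSpace → F.act h O ⊆ F.halfSpace)
    {A : 𝓐} (hA : A ∈ N.preDomain g) : N.α h A ∈ N.pos := by
  have : N.preDomain g ≤
      (Subalgebra.toSubmodule N.pos.toSubalgebra).comap
        ((N.α h : 𝓐 →⋆ₐ[ℂ] 𝓐).toAlgHom.toLinearMap) := by
    refine iSup_le fun O B hB => ?_
    exact N.α_mem h (hh O.1 O.2.2.1 O.2.2.2.1 O.2.2.2.2) hB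
  exact this hA

/-- `V(g)` is well defined: its graph is the one above. -/
theorem graph_V (g : F.group) : (S.V g).graph = S.graph g := by
  refine Submodule.toLinearPMap_graph_eq _ ?_
  rintro _ ⟨A, B, hA, hB, rfl⟩ h0
  have hC : N.α ((F.gamma g)⁻¹ * g) A ∈ N.pos := mem_of_preDomain g _ (fun _ _ _ h => h) hA
  have h0 : S.cls A = 0 := h0
  have key : ⟪S.cls B, S.cls B⟫_ℂ = ⟪S.cls A, S.cls ⟨_, hC⟩⟫_ℂ := by
    have hι : ∀ X : 𝓐, S.ι (S.ι X) = X := fun X => by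
      have h1 := S.ι_α_ι 1 X
      have h2 : F.gamma 1 = 1 := by
        apply Subtype.ext
        apply AffineIsometryEquiv.ext
        intro x
        exact F.r_r x
      simpa [h2] using h1
    rw [inner_cls, inner_cls, hB]
    have h3 : S.ι (star (N.α g (A : 𝓐))) = N.α (F.gamma g) (S.ι (star (A : 𝓐))) := by
      rw [← S.ι_α_ι, hι, map_star (N.α g)]
    have h4 : ∀ (k h : F.group) (X : 𝓐), N.α k (N.α h X) = N.α (k * h) X := fun k h X => by
      rw [map_mul]; rfl
    have h5 : ∀ X : 𝓐, N.α 1 X = X := fun X => by rw [map_one]; rfl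
    rw [h3, ← S.invariant (F.gamma g)⁻¹, map_mul, h4, h4, inv_mul_cancel, h5]
  change S.cls B = 0
  rw [h0, inner_zero_left, inner_self_eq_zero] at key
  exact key

end ReflectionPositiveFunctional

/-- A strongly continuous semigroup of contractions on a Hilbert space. -/
structure IsContractionSemigroup {H : Type*} [NormedAddCommGroup H] [InnerProductSpace ℂ H]
    (T : ℝ≥0 → H →L[ℂ] H) : Prop where
  zero : T 0 = 1
  add : ∀ s t, T (s + t) = T s * T t
  norm_le : ∀ t, ‖T t‖ ≤ 1
  continuous : ∀ ψ, Continuous fun t => T t ψ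

/-- `T t = e^{-tK}`: the infinitesimal generator of the semigroup `T` is `-K`, i.e. `Kψ` is the
limit of `(ψ - T t ψ) / t` for `t ↓ 0`, with domain the vectors for which this limit exists. -/
def IsExpNeg {H : Type*} [NormedAddCommGroup H] [InnerProductSpace ℂ H]
    (T : ℝ≥0 → H →L[ℂ] H) (K : H →ₗ.[ℂ] H) : Prop :=
  ∀ ψ φ : H, (ψ, φ) ∈ K.graph ↔
    Filter.Tendsto (fun t : ℝ≥0 => ((t : ℝ)⁻¹ : ℂ) • (ψ - T t ψ)) (𝓝[>] 0) (𝓝 φ)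

/-- `(𝒰, 𝓓₀, V)` is a virtual representation of `E_θ(d)`. -/
structure IsVirtualRepresentation {d : ℕ} {F : Frame d} {𝓐 : Type*} [CStarAlgebra 𝓐]
    {N : CovariantNet F 𝓐} (S : ReflectionPositiveFunctional N) (U : Set F.group) : Prop where
  dense : Dense (S.D₀ : Set S.Hilbert)
  le_domain : ∀ g ∈ U, S.D₀ ≤ (S.V g).domain
  mul : ∀ g₁ ∈ U, ∀ g₂ (h₂ : g₂ ∈ U) (h₁₂ : g₁ * g₂ ∈ U) (Ψ : S.Hilbert) (hΨ : Ψ ∈ S.D₀),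
    ∃ h : S.V g₂ ⟨Ψ, le_domain g₂ h₂ hΨ⟩ ∈ (S.V g₁).domain,
      S.V g₁ ⟨S.V g₂ ⟨Ψ, le_domain g₂ h₂ hΨ⟩, h⟩ = S.V (g₁ * g₂) ⟨Ψ, le_domain _ h₁₂ hΨ⟩
  unitary : ∀ g ∈ F.spatial, ∃ W : S.Hilbert ≃ₗᵢ[ℂ] S.Hilbert,
    ∀ ψ : (S.V g).domain, S.V g ψ = W ψ
  hermitian : ∀ m ∈ F.mSpace, ∀ g ∈ U, F.IsExp m g → (S.V g).IsFormalAdjoint (S.V g)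
  continuous_one : ∀ (Ψ : S.Hilbert) (hΨ : Ψ ∈ S.D₀),
    Filter.Tendsto (fun g : U => S.V g.1 ⟨Ψ, le_domain g.1 g.2 hΨ⟩)
      (Filter.comap Subtype.val (𝓝 (1 : F.group))) (𝓝 Ψ)
  contraction : ∃ (T : ℝ≥0 → S.Hilbert →L[ℂ] S.Hilbert) (K : S.Hilbert →ₗ.[ℂ] S.Hilbert),
    IsContractionSemigroup T ∧ IsSelfAdjoint K ∧
    (∀ ψ : K.domain, 0 ≤ ⟪(ψ : S.Hilbert), K ψ⟫_ℂ) ∧ IsExpNeg T K ∧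
    ∀ t : ℝ≥0, (S.V (F.timeTranslation t)).domain = S.D ∧
      ∀ ψ : (S.V (F.timeTranslation t)).domain, S.V (F.timeTranslation t) ψ = T t ψ

end EuclideanNets

end

open scoped InnerProductSpace ComplexOrder Topology NNReal

noncomputable section

open Filter

/-! Everything rests on one identity: since `ι` intertwines `α_g` with `α_{γ(g)}` and `σ` is
invariant, ⟨[α_g A],[B]⟩ equals σ(ι(A*) α_{γ(g)⁻¹} B) (`form_α_left`). If γ(g) = g, it makes V(g)
isometric; if γ(g)⁻¹ = g, as for time translations and exponentials of 𝔪_θ, it makes V(g) hermitian.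
For B = α_g A it writes ‖V(g)[A]‖² through γ(g)⁻¹g, which gives continuity at 1.

Contractivity of the time translations: ‖T_t ψ‖² = ⟨ψ, T_{2t} ψ⟩ ≤ ‖ψ‖ ‖T_{2t} ψ‖ for ψ = [A]. The
orbit of ψ is bounded because `σ` is bounded and `α` isometric, so the supremum M of ‖T_t ψ‖
satisfies M² ≤ ‖ψ‖ M, hence M ≤ ‖ψ‖. The extension to the Hilbert space is a symmetric, strongly
continuous contraction semigroup. Its generator is self-adjoint by testing with orbit integrals, and
contractivity gives the sign.

Density of 𝓓₀ is an argument of Reeh–Schlieder type. A symmetric contraction semigroup is injective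
at every time, so each vector lies in the closed span of the late part of its own orbit
(`mem_closure_span_orbit`). Late translates of a bounded region lie in the cone, so classes of local
elements are limits of vectors in 𝓓₀, and local elements are dense.

The existence of an admissible neighborhood is an estimate of time components on the cone, where ‖v‖
is bounded by twice the time component of v (`isAdmissible_smallSet`). The multiplication law
follows because the admissibility conditions put α_{g₂} A, localized in g₂C, into the domain of
V(g₁). -/

namespace EuclideanNets

/-! ### Symmetric contraction semigroups and their generators -/

section Semigroup

variable {H : Type*} [NormedAddCommGroup H] [InnerProductSpace ℂ H] {T : ℝ≥0 → H →L[ℂ] H}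

/-- The graph of the negative of the infinitesimal generator of `T`. -/
def generatorGraph (T : ℝ≥0 → H →L[ℂ] H) : Submodule ℂ (H × H) where
  carrier := {p | Tendsto (fun t : ℝ≥0 => ((t : ℝ)⁻¹ : ℂ) • (p.1 - T t p.1)) (𝓝[>] 0) (𝓝 p.2)}
  zero_mem' := by simp
  add_mem' := by
    intro p q hp hq
    refine (Tendsto.add hp hq).congr fun t => ?_
    rw [← smul_add, Prod.fst_add, map_add]
    congr 1
    abel
  smul_mem' := by
    intro c p hp
    refine (Tendsto.const_smul hp c).congr fun t => ?_
    rw [smul_comm, smul_sub, Prod.smul_fst, map_smul]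

/-- The negative of the infinitesimal generator of `T`. -/
def negGenerator (T : ℝ≥0 → H →L[ℂ] H) : H →ₗ.[ℂ] H := (generatorGraph T).toLinearPMap

theorem graph_negGenerator (T : ℝ≥0 → H →L[ℂ] H) : (negGenerator T).graph = generatorGraph T := by
  refine Submodule.toLinearPMap_graph_eq _ ?_
  rintro ⟨ψ, φ⟩ h h0
  change ψ = 0 at h0
  subst h0
  have h' : Tendsto (fun t : ℝ≥0 => ((t : ℝ)⁻¹ : ℂ) • ((0 : H) - T t 0)) (𝓝[>] 0) (𝓝 φ) := h
  simp only [map_zero, sub_zero, smul_zero] at h'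
  exact tendsto_nhds_unique h' tendsto_const_nhds

theorem isExpNeg_negGenerator (T : ℝ≥0 → H →L[ℂ] H) : IsExpNeg T (negGenerator T) := by
  intro ψ φ
  rw [graph_negGenerator]
  rfl

/-- The orbit integral `∫₀ˢ T u ψ du`. -/
def orbitIntegral (T : ℝ≥0 → H →L[ℂ] H) (s : ℝ) (ψ : H) : H := ∫ u in (0 : ℝ)..s, T u.toNNReal ψ

namespace IsContractionSemigroup

variable (hT : IsContractionSemigroup T)
include hT

theorem norm_apply_le (t : ℝ≥0) (ψ : H) : ‖T t ψ‖ ≤ ‖ψ‖ := by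
  simpa using (T t).le_of_opNorm_le (hT.norm_le t) ψ

theorem continuous_orbit (ψ : H) : Continuous fun u : ℝ => T u.toNNReal ψ :=
  (hT.continuous ψ).comp continuous_real_toNNReal

variable [CompleteSpace H]

theorem tendsto_orbitIntegral (ψ : H) :
    Tendsto (fun t : ℝ≥0 => ((t : ℝ)⁻¹ : ℂ) • orbitIntegral T t ψ) (𝓝[>] 0) (𝓝 ψ) := by
  have hc := hT.continuous_orbit ψ
  have h1 : HasDerivAt (fun s : ℝ => orbitIntegral T s ψ) (T (0 : ℝ).toNNReal ψ) 0 :=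
    intervalIntegral.integral_hasDerivAt_right (hc.intervalIntegrable _ _)
      (hc.stronglyMeasurableAtFilter _ _) hc.continuousAt
  rw [Real.toNNReal_zero, hT.zero] at h1
  have h2 := h1.tendsto_slope_zero_right
  have h3 : Tendsto (fun t : ℝ≥0 => (t : ℝ)) (𝓝[>] 0) (𝓝[>] 0) := by
    refine tendsto_nhdsWithin_iff.2 ⟨?_, ?_⟩
    · exact (NNReal.continuous_coe.tendsto' _ _ rfl).mono_left nhdsWithin_le_nhds
    · filter_upwards [self_mem_nhdsWithin] with t ht
      exact NNReal.coe_pos.2 ht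
  refine (h2.comp h3).congr fun t => ?_
  simp only [Function.comp_apply, zero_add, orbitIntegral, intervalIntegral.integral_same, sub_zero]
  rw [← Complex.ofReal_inv, Complex.coe_smul]

theorem apply_orbitIntegral (s t : ℝ≥0) (ψ : H) :
    T t (orbitIntegral T s ψ) = orbitIntegral T (t + s) ψ - orbitIntegral T t ψ := by
  have hc := hT.continuous_orbit ψ
  rw [orbitIntegral, ← ContinuousLinearMap.intervalIntegral_comp_comm _ (hc.intervalIntegrable _ _),
    orbitIntegral, orbitIntegral, intervalIntegral.integral_interval_sub_left
      (hc.intervalIntegrable _ _) (hc.intervalIntegrable _ _)]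
  have h := intervalIntegral.integral_comp_add_left (a := 0) (b := s)
    (fun u : ℝ => T u.toNNReal ψ) (t : ℝ)
  rw [add_zero] at h
  rw [← h]
  refine intervalIntegral.integral_congr fun u hu => ?_
  rw [Set.uIcc_of_le s.coe_nonneg] at hu
  rw [Real.toNNReal_add t.coe_nonneg hu.1, Real.toNNReal_coe, hT.add]
  rfl

/-- Applying T t to an orbit integral only changes its two ends, so the difference quotient of the
integral up to s is the mean of the orbit of ψ over [0, t] minus its image under T s. These vectors
show that the domain is dense and serve as test vectors for self-adjointness. -/
theorem orbitIntegral_mem_generatorGraph (s : ℝ≥0) (ψ : H) :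
    (orbitIntegral T s ψ, ψ - T s ψ) ∈ generatorGraph T := by
  have h1 := hT.tendsto_orbitIntegral ψ
  have h2 := h1.sub (((T s).continuous.tendsto ψ).comp h1)
  refine h2.congr fun t => ?_
  simp only [Function.comp_apply, map_smul]
  rw [← smul_sub, hT.apply_orbitIntegral, hT.apply_orbitIntegral, add_comm (s : ℝ)]
  congr 1
  abel

theorem dense_negGenerator : Dense ((negGenerator T).domain : Set H) := by
  intro ψ
  refine mem_closure_of_tendsto (hT.tendsto_orbitIntegral ψ) (Eventually.of_forall fun t => ?_)
  refine Submodule.smul_mem _ _ (LinearPMap.mem_domain_iff.2 ⟨ψ - T t ψ, ?_⟩)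
  rw [graph_negGenerator]
  exact hT.orbitIntegral_mem_generatorGraph t ψ

theorem inner_orbitIntegral (hs : ∀ t ψ φ, ⟪T t ψ, φ⟫_ℂ = ⟪ψ, T t φ⟫_ℂ) (s : ℝ) (ψ φ : H) :
    ⟪orbitIntegral T s ψ, φ⟫_ℂ = ⟪ψ, orbitIntegral T s φ⟫_ℂ := by
  have key : ∀ χ η : H, ⟪χ, orbitIntegral T s η⟫_ℂ = ∫ u in (0 : ℝ)..s, ⟪χ, T u.toNNReal η⟫_ℂ :=
    fun χ η => ((innerSL ℂ χ).intervalIntegral_comp_comm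
      ((hT.continuous_orbit η).intervalIntegrable _ _)).symm
  rw [← inner_conj_symm, key, key, ← intervalIntegral.intervalIntegral_conj]
  refine intervalIntegral.integral_congr fun u _ => ?_
  simp only [inner_conj_symm, hs]

theorem isSelfAdjoint_negGenerator (hs : ∀ t ψ φ, ⟪T t ψ, φ⟫_ℂ = ⟪ψ, T t φ⟫_ℂ) :
    IsSelfAdjoint (negGenerator T) := by
  rw [LinearPMap.isSelfAdjoint_def]
  refine LinearPMap.eq_of_eq_graph ?_
  rw [LinearPMap.adjoint_graph_eq_graph_adjoint hT.dense_negGenerator, graph_negGenerator]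
  ext ⟨φ, χ⟩
  rw [Submodule.mem_adjoint_iff]
  simp only [sub_eq_zero]
  constructor
  · intro h
    -- Pairing with the orbit integral of an arbitrary ψ and moving the integral to the other side
    -- gives the integrated form of the generator equation; dividing by s and letting s ↓ 0 recovers
    -- it.
    have h1 : ∀ s : ℝ≥0, φ - T s φ = orbitIntegral T s χ := fun s => by
      refine ext_inner_left ℂ fun ψ => ?_
      have h2 := h _ _ (hT.orbitIntegral_mem_generatorGraph s ψ)
      rw [hT.inner_orbitIntegral hs, inner_sub_left, hs, ← inner_sub_right] at h2
      exact h2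
    refine (hT.tendsto_orbitIntegral χ).congr fun t => ?_
    rw [h1]
  · intro h a b hab
    have hab' : Tendsto (fun t : ℝ≥0 => ((t : ℝ)⁻¹ : ℂ) • (a - T t a)) (𝓝[>] 0) (𝓝 b) := hab
    have h' : Tendsto (fun t : ℝ≥0 => ((t : ℝ)⁻¹ : ℂ) • (φ - T t φ)) (𝓝[>] 0) (𝓝 χ) := h
    -- The difference quotients are symmetric operators, and symmetry passes to the limit.
    refine tendsto_nhds_unique (hab'.inner tendsto_const_nhds)
      ((tendsto_const_nhds.inner h').congr fun t => ?_)
    rw [inner_smul_left, inner_smul_right, inner_sub_left, inner_sub_right, hs,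
      ← Complex.ofReal_inv, Complex.conj_ofReal]

omit [CompleteSpace H] in
theorem inner_sub_nonneg (hs : ∀ t ψ φ, ⟪T t ψ, φ⟫_ℂ = ⟪ψ, T t φ⟫_ℂ) (t : ℝ≥0) (ψ : H) :
    0 ≤ ⟪ψ, ψ - T t ψ⟫_ℂ := by
  rw [Complex.nonneg_iff]
  refine ⟨?_, ?_⟩
  · rw [inner_sub_right, Complex.sub_re, sub_nonneg]
    calc (⟪ψ, T t ψ⟫_ℂ).re ≤ ‖ψ‖ * ‖T t ψ‖ := re_inner_le_norm (𝕜 := ℂ) _ _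
      _ ≤ ‖ψ‖ * ‖ψ‖ := by gcongr; exact hT.norm_apply_le t ψ
      _ = (⟪ψ, ψ⟫_ℂ).re := (inner_self_eq_norm_mul_norm (𝕜 := ℂ) ψ).symm
  · have h : (starRingEnd ℂ) ⟪ψ, ψ - T t ψ⟫_ℂ = ⟪ψ, ψ - T t ψ⟫_ℂ := by
      rw [inner_conj_symm, inner_sub_left, inner_sub_right, hs]
    exact (Complex.conj_eq_iff_im.1 h).symm

omit [CompleteSpace H] in
theorem negGenerator_nonneg (hs : ∀ t ψ φ, ⟪T t ψ, φ⟫_ℂ = ⟪ψ, T t φ⟫_ℂ)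
    (ψ : (negGenerator T).domain) : 0 ≤ ⟪(ψ : H), negGenerator T ψ⟫_ℂ := by
  have h := (isExpNeg_negGenerator T _ _).1 ((negGenerator T).mem_graph ψ)
  refine ge_of_tendsto' (tendsto_const_nhds.inner h) fun t => ?_
  rw [inner_smul_right, ← Complex.ofReal_inv]
  exact mul_nonneg (Complex.zero_le_real.2 (by positivity)) (hT.inner_sub_nonneg hs t ψ)

omit [CompleteSpace H] in
/-- A vector that a symmetric contraction semigroup annihilates at some time is zero. -/
theorem eq_zero_of_apply_eq_zero (hs : ∀ t ψ φ, ⟪T t ψ, φ⟫_ℂ = ⟪ψ, T t φ⟫_ℂ) {t : ℝ≥0} {φ : H}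
    (h : T t φ = 0) : φ = 0 := by
  have h1 : ∀ n : ℕ, T (t / 2 ^ n) φ = 0 := fun n => by
    induction n with
    | zero => simpa using h
    | succ n ih =>
      have h2 : T (t / 2 ^ n) φ = T (t / 2 ^ (n + 1)) (T (t / 2 ^ (n + 1)) φ) := by
        have h3 : t / 2 ^ n = t / 2 ^ (n + 1) + t / 2 ^ (n + 1) := by
          rw [pow_succ, ← div_div, add_halves]
        rw [h3, hT.add]
        rfl
      -- By symmetry ‖T_u φ‖² = ⟨φ, T_{2u} φ⟩, so vanishing at one time descends to half that time;
      -- strong continuity at 0 then finishes.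
      rw [← inner_self_eq_zero (𝕜 := ℂ), hs, ← h2, ih, inner_zero_right]
  have h4 : Tendsto (fun n : ℕ => t / 2 ^ n) atTop (𝓝 0) := by
    have := (tendsto_inv_atTop_zero.comp
      (tendsto_pow_atTop_atTop_of_one_lt (one_lt_two (α := ℝ≥0)))).const_mul t
    simpa [div_eq_mul_inv, Function.comp_def] using this
  have h5 := ((hT.continuous φ).tendsto 0).comp h4
  rw [hT.zero] at h5
  exact tendsto_nhds_unique h5 (tendsto_const_nhds.congr fun n => (h1 n).symm)

/-- The late part of an orbit of a symmetric contraction semigroup spans the whole orbit. -/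
theorem mem_closure_span_orbit (hs : ∀ t ψ φ, ⟪T t ψ, φ⟫_ℂ = ⟪ψ, T t φ⟫_ℂ) (t : ℝ≥0) (φ : H) :
    φ ∈ (Submodule.span ℂ {ψ | ∃ s, t ≤ s ∧ ψ = T s φ}).topologicalClosure := by
  set M := Submodule.span ℂ {ψ | ∃ s, t ≤ s ∧ ψ = T s φ}
  -- The span is invariant because times only grow; by symmetry its orthogonal complement is
  -- invariant too.
  have hinv : ∀ u, ∀ ψ ∈ M, T u ψ ∈ M := by
    intro u ψ hψ
    have : M ≤ M.comap (T u).toLinearMap := by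
      refine Submodule.span_le.2 ?_
      rintro _ ⟨s, hts, rfl⟩
      refine Submodule.subset_span ⟨u + s, hts.trans le_add_self, ?_⟩
      rw [hT.add]
      rfl
    exact this hψ
  have hperp : ∀ u, ∀ ψ ∈ Mᗮ, T u ψ ∈ Mᗮ := by
    intro u ψ hψ
    rw [Submodule.mem_orthogonal] at hψ ⊢
    intro χ hχ
    rw [← hs]
    exact hψ _ (hinv u χ hχ)
  have : CompleteSpace M.topologicalClosure :=
    M.isClosed_topologicalClosure.completeSpace_coe
  obtain ⟨φ₁, h₁, φ₂, h₂, h⟩ :=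
    Submodule.exists_add_mem_mem_orthogonal (K := M.topologicalClosure) φ
  rw [Submodule.orthogonal_closure] at h₂
  have hφ₁ : T t φ₁ ∈ M.topologicalClosure := by
    have := map_mem_closure (T t).continuous (s := (M : Set H)) (t := (M : Set H)) h₁ (hinv t)
    exact this
  have hφ : T t φ ∈ M.topologicalClosure :=
    M.le_topologicalClosure (Submodule.subset_span ⟨t, le_rfl, rfl⟩)
  have hφ₂ : T t φ₂ ∈ M.topologicalClosure := by
    have : T t φ₂ = T t φ - T t φ₁ := by rw [h, map_add]; abel
    rw [this]
    exact sub_mem hφ hφ₁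
  -- This vector lies both in the closed span and in its complement; injectivity of T t then kills
  -- the orthogonal component of φ.
  have h0 : T t φ₂ = 0 := by
    have hp : T t φ₂ ∈ M.topologicalClosureᗮ := by
      rw [Submodule.orthogonal_closure]
      exact hperp t φ₂ h₂
    rw [← inner_self_eq_zero (𝕜 := ℂ)]
    exact (Submodule.mem_orthogonal _ _).1 hp _ hφ₂
  rw [h, hT.eq_zero_of_apply_eq_zero hs h0, add_zero]
  exact h₁

end IsContractionSemigroup

end Semigroup

/-! ### Geometry of the reduced Euclidean group -/

namespace Frame

variable {d : ℕ} (F : Frame d)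

theorem inner_e_e : ⟪F.e, F.e⟫_ℝ = 1 := by
  rw [real_inner_self_eq_norm_sq, F.norm_e, one_pow]

theorem inner_r (x : Space d) : ⟪F.e, F.r x⟫_ℝ = -⟪F.e, x⟫_ℝ := by
  rw [r_apply, inner_sub_right, inner_smul_right, inner_e_e]
  ring

theorem group_apply (g : F.group) (v : Space d) :
    g.1 v = g.1.linearIsometryEquiv v + g.1 0 := by
  simpa using g.1.map_vadd 0 v

theorem apply_inv_self (g : F.group) (v : Space d) : g.1 ((g⁻¹).1 v) = v := g.1.apply_symm_apply v

theorem inv_apply (g : F.group) (v : Space d) :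
    (g⁻¹).1 v = g.1.linearIsometryEquiv.symm (v - g.1 0) := by
  rw [LinearIsometryEquiv.eq_symm_apply, eq_sub_iff_add_eq, ← group_apply, apply_inv_self]

theorem gamma_apply (g : F.group) (v : Space d) : (F.gamma g).1 v = F.r (g.1 (F.r v)) := rfl

theorem group_ext {g h : F.group} (H : ∀ v, g.1 v = h.1 v) : g = h :=
  Subtype.ext (AffineIsometryEquiv.ext H)

theorem gamma_one : F.gamma 1 = 1 := F.group_ext F.r_r

theorem gamma_inv (g : F.group) : (F.gamma g)⁻¹ = F.gamma g⁻¹ := by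
  rw [inv_eq_iff_mul_eq_one]
  refine F.group_ext fun v => ?_
  change F.r (g.1 (F.r (F.r ((g⁻¹).1 (F.r v))))) = v
  rw [r_r, apply_inv_self, r_r]

theorem gamma_inv_mul_apply (g : F.group) (v : Space d) :
    ((F.gamma g)⁻¹ * g).1 v = F.r ((g⁻¹).1 (F.r (g.1 v))) := by
  rw [gamma_inv]
  rfl

theorem act_mul (g h : F.group) (X : Set (Space d)) : F.act (g * h) X = F.act g (F.act h X) :=
  (Set.image_image (fun v => g.1 v) (fun v => h.1 v) X).symm

theorem isOpen_act (g : F.group) {X : Set (Space d)} (hX : IsOpen X) : IsOpen (F.act g X) :=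
  g.1.toHomeomorph.isOpenMap _ hX

theorem isOpen_halfSpace : IsOpen F.halfSpace :=
  isOpen_lt continuous_const (by fun_prop)

theorem isOpen_cone : IsOpen F.cone :=
  isOpen_lt (by fun_prop) (by fun_prop)

theorem one_lt_of_mem_cone {v : Space d} (hv : v ∈ F.cone) : 1 < ⟪F.e, v⟫_ℝ := by
  have h : 1 + ‖v - ⟪F.e, v⟫_ℝ • F.e‖ < ⟪F.e, v⟫_ℝ := hv
  linarith [norm_nonneg (v - ⟪F.e, v⟫_ℝ • F.e)]

theorem cone_subset_halfSpace : F.cone ⊆ F.halfSpace := fun _ hv =>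
  zero_lt_one.trans (F.one_lt_of_mem_cone hv)

theorem norm_le_of_mem_cone {v : Space d} (hv : v ∈ F.cone) : ‖v‖ ≤ 2 * ⟪F.e, v⟫_ℝ := by
  have h : 1 + ‖v - ⟪F.e, v⟫_ℝ • F.e‖ < ⟪F.e, v⟫_ℝ := hv
  have h1 : ‖v‖ ≤ ‖v - ⟪F.e, v⟫_ℝ • F.e‖ + ‖⟪F.e, v⟫_ℝ • F.e‖ := by
    simpa using norm_add_le (v - ⟪F.e, v⟫_ℝ • F.e) (⟪F.e, v⟫_ℝ • F.e)
  rw [norm_smul, F.norm_e, mul_one, Real.norm_of_nonneg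
    (zero_le_one.trans (F.one_lt_of_mem_cone hv).le)] at h1
  linarith

/-! ### Existence of admissible neighborhoods -/

/-- The time component of `γ_e(g)⁻¹ g w`. -/
theorem inner_gamma_inv_mul (g : F.group) (w : Space d) :
    ⟪F.e, ((F.gamma g)⁻¹ * g).1 w⟫_ℝ =
      2 * ⟪F.e, g.1.linearIsometryEquiv F.e⟫_ℝ * ⟪F.e, g.1 w⟫_ℝ - ⟪F.e, w⟫_ℝ := by
  have h1 : ∀ z, ⟪F.e, g.1.linearIsometryEquiv.symm z⟫_ℝ =
      ⟪g.1.linearIsometryEquiv F.e, z⟫_ℝ := fun z => by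
    rw [← g.1.linearIsometryEquiv.inner_map_map, LinearIsometryEquiv.apply_symm_apply]
  have h2 : F.r (g.1 w) - g.1 0 =
      g.1.linearIsometryEquiv w - (2 * ⟪F.e, g.1 w⟫_ℝ) • F.e := by
    rw [r_apply]
    nth_rw 1 [group_apply]
    abel
  rw [gamma_inv_mul_apply, inner_r, inv_apply, h1, h2, inner_sub_right, inner_smul_right,
    LinearIsometryEquiv.inner_map_map, real_inner_comm F.e (g.1.linearIsometryEquiv F.e)]
  ring

/-- The standard admissible neighborhood: small time shift and small boost. -/
def smallSet : Set F.group :=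
  {g | |⟪F.e, g.1 0⟫_ℝ| < 1 / 16 ∧ ‖g.1.linearIsometryEquiv F.e - F.e‖ < 1 / 16}

theorem abs_inner_apply_sub_le {g : F.group} (hg : g ∈ F.smallSet) {v : Space d}
    (hv : v ∈ F.cone) : |⟪F.e, g.1 v⟫_ℝ - ⟪F.e, v⟫_ℝ| ≤ 1 / 16 + ⟪F.e, v⟫_ℝ / 8 := by
  have h1 : ⟪F.e, g.1.linearIsometryEquiv v⟫_ℝ =
      ⟪g.1.linearIsometryEquiv.symm F.e, v⟫_ℝ := by
    rw [← g.1.linearIsometryEquiv.inner_map_map (g.1.linearIsometryEquiv.symm F.e),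
      LinearIsometryEquiv.apply_symm_apply]
  -- Applying the isometry R shows that R⁻¹ moves e exactly as far as R does.
  have h2 : ‖g.1.linearIsometryEquiv.symm F.e - F.e‖ < 1 / 16 := by
    rw [← g.1.linearIsometryEquiv.norm_map, map_sub, LinearIsometryEquiv.apply_symm_apply,
      norm_sub_rev]
    exact hg.2
  have h3 : |⟪g.1.linearIsometryEquiv.symm F.e - F.e, v⟫_ℝ| ≤ 1 / 16 * (2 * ⟪F.e, v⟫_ℝ) :=
    (abs_real_inner_le_norm _ _).trans
      (mul_le_mul h2.le (F.norm_le_of_mem_cone hv) (norm_nonneg _) (by norm_num))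
  rw [inner_sub_left, ← h1] at h3
  rw [group_apply, inner_add_right]
  have h4 := hg.1
  rw [abs_lt] at h4
  rw [abs_le] at h3 ⊢
  constructor <;> linarith [h3.1, h3.2, h4.1, h4.2]

theorem inner_boost_ge {g : F.group} (hg : g ∈ F.smallSet) :
    15 / 16 ≤ ⟪F.e, g.1.linearIsometryEquiv F.e⟫_ℝ := by
  have h := abs_real_inner_le_norm F.e (g.1.linearIsometryEquiv F.e - F.e)
  rw [F.norm_e, one_mul, inner_sub_right, inner_e_e] at h
  have h2 := hg.2
  rw [abs_le] at h
  linarith [h.1]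

/-- The coordinates `(x, R)` of an element of `E_θ(d)`. -/
def coord (g : F.group) : Space d × (Space d →L[ℝ] Space d) :=
  (g.1 0, (g.1.linearIsometryEquiv.toContinuousLinearEquiv : Space d →L[ℝ] Space d))

theorem continuous_coord : Continuous F.coord := by
  have h : Continuous fun g : EuclideanGroup d =>
      (g 0, (g.linearIsometryEquiv.toContinuousLinearEquiv : Space d →L[ℝ] Space d)) :=
    continuous_induced_dom
  exact h.comp continuous_subtype_val

theorem continuous_of_coord {X : Type*} [TopologicalSpace X] {f : X → F.group}
    (h : Continuous fun x => F.coord (f x)) : Continuous f :=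
  Continuous.subtype_mk (continuous_induced_rng.2 h) _

theorem smallSet_mem_nhds : F.smallSet ∈ 𝓝 (1 : F.group) := by
  have h1 : Continuous fun g : F.group => |⟪F.e, g.1 0⟫_ℝ| :=
    (continuous_const.inner F.continuous_coord.fst).abs
  have h2 : Continuous fun g : F.group => ‖g.1.linearIsometryEquiv F.e - F.e‖ :=
    ((F.continuous_coord.snd.clm_apply continuous_const).sub continuous_const).norm
  refine ((isOpen_lt h1 continuous_const).inter (isOpen_lt h2 continuous_const)).mem_nhds ⟨?_, ?_⟩
  · change |⟪F.e, (0 : Space d)⟫_ℝ| < 1 / 16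
    simp
  · change ‖F.e - F.e‖ < 1 / 16
    simp

theorem inner_zero_of_mem_spatial {g : F.group} (hg : g ∈ F.spatial) : ⟪F.e, g.1 0⟫_ℝ = 0 := by
  have h : F.r (g.1 0) = g.1 0 := by
    have := F.gamma_apply g 0
    rw [hg.1, map_zero F.r] at this
    exact this.symm
  have h2 := F.inner_r (g.1 0)
  rw [h] at h2
  linarith

theorem isAdmissible_smallSet : F.IsAdmissible F.smallSet where
  mem_nhds := F.smallSet_mem_nhds
  spatial_subset g hg := by
    refine ⟨?_, ?_⟩
    · rw [F.inner_zero_of_mem_spatial hg]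
      norm_num
    · rw [hg.2]
      norm_num
  act_cone := by
    rintro g hg _ ⟨v, hv, rfl⟩
    have h1 := (abs_le.1 (F.abs_inner_apply_sub_le hg hv)).1
    have h2 := F.one_lt_of_mem_cone hv
    change 0 < ⟪F.e, g.1 v⟫_ℝ
    linarith
  -- With x₀ > 1 the time component of v, that of gv is at least 7x₀/8 − 1/16; the reflected point
  -- then has at least (15/8)(7x₀/8 − 1/16) − x₀ > 0.
  act_cone_gamma := by
    rintro g hg _ ⟨v, hv, rfl⟩
    have h1 := (abs_le.1 (F.abs_inner_apply_sub_le hg hv)).1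
    have h2 := F.one_lt_of_mem_cone hv
    change 0 < ⟪F.e, ((F.gamma g)⁻¹ * g).1 v⟫_ℝ
    rw [inner_gamma_inv_mul]
    have h3 := mul_le_mul_of_nonneg_right (F.inner_boost_ge hg)
      (show 0 ≤ ⟪F.e, g.1 v⟫_ℝ by linarith)
    linarith
  act_cone_mul := by
    rintro g₁ hg₁ g₂ hg₂ hg _ ⟨v, hv, rfl⟩
    have h1 := (abs_le.1 (F.abs_inner_apply_sub_le hg hv)).1
    have h1' := (abs_le.1 (F.abs_inner_apply_sub_le hg₂ hv)).2
    have h2 := F.one_lt_of_mem_cone hv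
    change 0 < ⟪F.e, ((F.gamma g₁)⁻¹ * g₁).1 (g₂.1 v)⟫_ℝ
    rw [inner_gamma_inv_mul]
    have h3 := mul_le_mul_of_nonneg_right (F.inner_boost_ge hg₁)
      (show 0 ≤ ⟪F.e, (g₁ * g₂).1 v⟫_ℝ by linarith)
    -- The time component of g₁g₂v is controlled directly by membership of g₁g₂ in the set, so no
    -- estimate for g₁ outside the cone is needed.
    have h4 : g₁.1 (g₂.1 v) = (g₁ * g₂).1 v := rfl
    rw [h4]
    linarith

/-! ### Continuity of `g ↦ γ_e(g)⁻¹ g` -/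

/-- The inverse of a rotation is its adjoint, which depends continuously on it; hence the
coordinates of γ(g)⁻¹g are continuous expressions in those of g. -/
theorem continuous_gamma_inv_mul : Continuous fun g : F.group => (F.gamma g)⁻¹ * g := by
  let ρ : Space d →L[ℝ] Space d := F.r.toContinuousLinearEquiv
  let adj : (Space d →L[ℝ] Space d) → (Space d →L[ℝ] Space d) := fun A => A.adjoint
  have hadj : Continuous adj := ContinuousLinearMap.adjoint.continuous
  have hsymm : ∀ (g : F.group) (v : Space d),
      g.1.linearIsometryEquiv.symm v = adj (F.coord g).2 v := fun g v => by
    refine ext_inner_right ℝ fun w => ?_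
    rw [ContinuousLinearMap.adjoint_inner_left, ← g.1.linearIsometryEquiv.inner_map_map,
      LinearIsometryEquiv.apply_symm_apply]
    rfl
  have key : ∀ g : F.group, F.coord ((F.gamma g)⁻¹ * g) =
      (ρ (adj (F.coord g).2 (ρ (F.coord g).1 - (F.coord g).1)),
        ((ρ.comp (adj (F.coord g).2)).comp ρ).comp (F.coord g).2) := fun g => by
    have h0 : ((F.gamma g)⁻¹ * g).1 0 =
        ρ (adj (F.coord g).2 (ρ (F.coord g).1 - (F.coord g).1)) := by
      rw [gamma_inv_mul_apply, inv_apply, hsymm]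
      rfl
    refine Prod.ext h0 (ContinuousLinearMap.ext fun v => ?_)
    have hv := F.group_apply ((F.gamma g)⁻¹ * g) v
    rw [h0, gamma_inv_mul_apply, inv_apply, hsymm] at hv
    change ((F.gamma g)⁻¹ * g).1.linearIsometryEquiv v =
      ρ (adj (F.coord g).2 (ρ ((F.coord g).2 v)))
    rw [← sub_eq_iff_eq_add] at hv
    rw [← hv]
    change ρ _ - ρ _ = ρ _
    have hg : F.r (g.1 v) = ρ ((F.coord g).2 v) + ρ (F.coord g).1 := by
      rw [group_apply, map_add]
      rfl
    rw [← map_sub, ← map_sub, hg]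
    congr 2
    change _ + _ - (F.coord g).1 - _ = _
    abel
  refine F.continuous_of_coord ?_
  simp only [key]
  have h1 := F.continuous_coord.fst
  have h2 := F.continuous_coord.snd
  have h3 := hadj.comp h2
  refine Continuous.prodMk ?_ ?_
  · exact ρ.continuous.comp (h3.clm_apply ((ρ.continuous.comp h1).sub h1))
  · exact ((continuous_const.clm_comp h3).clm_comp continuous_const).clm_comp h2

/-! ### Time translations -/

theorem timeTranslation_apply (t : ℝ) (v : Space d) :
    (F.timeTranslation t).1 v = t • F.e + v := rfl

theorem continuous_timeTranslation : Continuous F.timeTranslation := by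
  have h : ∀ t, F.coord (F.timeTranslation t) =
      (t • F.e + 0, ContinuousLinearMap.id ℝ (Space d)) := fun t => rfl
  refine F.continuous_of_coord ?_
  simp only [h]
  fun_prop

theorem timeTranslation_add (s t : ℝ) :
    F.timeTranslation (s + t) = F.timeTranslation s * F.timeTranslation t := by
  refine F.group_ext fun v => ?_
  change (s + t) • F.e + v = s • F.e + (t • F.e + v)
  rw [add_smul, add_assoc]

theorem timeTranslation_zero : F.timeTranslation 0 = 1 := by
  refine F.group_ext fun v => ?_
  change (0 : ℝ) • F.e + v = v
  rw [zero_smul, zero_add]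

theorem gamma_timeTranslation_inv (t : ℝ) :
    (F.gamma (F.timeTranslation t))⁻¹ = F.timeTranslation t := by
  rw [inv_eq_iff_mul_eq_one]
  refine F.group_ext fun v => ?_
  change F.r (t • F.e + F.r (t • F.e + v)) = v
  have h : F.r (t • F.e) = -(t • F.e) := by
    rw [r_apply, inner_smul_right, inner_e_e]
    module
  rw [map_add, r_r, h]
  abel

theorem inner_timeTranslation (t : ℝ) (v : Space d) :
    ⟪F.e, (F.timeTranslation t).1 v⟫_ℝ = t + ⟪F.e, v⟫_ℝ := by
  rw [timeTranslation_apply, inner_add_right, inner_smul_right, inner_e_e, mul_one]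

theorem act_timeTranslation_halfSpace {t : ℝ} (ht : 0 ≤ t) :
    F.act (F.timeTranslation t) F.halfSpace ⊆ F.halfSpace := by
  rintro _ ⟨v, hv, rfl⟩
  change 0 < ⟪F.e, (F.timeTranslation t).1 v⟫_ℝ
  rw [inner_timeTranslation]
  exact add_pos_of_nonneg_of_pos ht hv

/-- Large time translations move bounded sets into the cone. -/
theorem exists_act_timeTranslation_subset_cone {O : Set (Space d)} (hO : Bornology.IsBounded O) :
    ∃ t : ℝ≥0, ∀ s : ℝ≥0, t ≤ s → F.act (F.timeTranslation s) O ⊆ F.cone := by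
  obtain ⟨B, hB⟩ := hO.exists_norm_le
  -- For ‖v‖ ≤ B the part orthogonal to e has norm at most 2B and the time component is at least −B,
  -- so a shift above 1 + 3B is enough; the 2 makes the inequality strict.
  refine ⟨(2 + 3 * B).toNNReal, fun s hs => ?_⟩
  rintro _ ⟨v, hv, rfl⟩
  have hv' := hB v hv
  have hs' : 2 + 3 * B ≤ s := Real.toNNReal_le_iff_le_coe.1 hs
  have h1 := abs_real_inner_le_norm F.e v
  rw [F.norm_e, one_mul] at h1
  have h2 := norm_sub_le v (⟪F.e, v⟫_ℝ • F.e)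
  rw [norm_smul, F.norm_e, mul_one, Real.norm_eq_abs] at h2
  change 1 + ‖(F.timeTranslation s).1 v - ⟪F.e, (F.timeTranslation s).1 v⟫_ℝ • F.e‖ <
    ⟪F.e, (F.timeTranslation s).1 v⟫_ℝ
  rw [inner_timeTranslation, timeTranslation_apply, add_smul, add_sub_add_left_eq_sub]
  linarith [neg_abs_le ⟪F.e, v⟫_ℝ]

/-! ### The spatial subgroup and the exponentials of `𝔪_θ` -/

theorem inner_spatial {g : F.group} (hg : g ∈ F.spatial) (v : Space d) :
    ⟪F.e, g.1 v⟫_ℝ = ⟪F.e, v⟫_ℝ := by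
  rw [group_apply, inner_add_right, F.inner_zero_of_mem_spatial hg, add_zero]
  nth_rw 1 [← hg.2]
  exact g.1.linearIsometryEquiv.inner_map_map _ _

theorem act_spatial_halfSpace {g : F.group} (hg : g ∈ F.spatial) :
    F.act g F.halfSpace ⊆ F.halfSpace := by
  rintro _ ⟨v, hv, rfl⟩
  change 0 < ⟪F.e, g.1 v⟫_ℝ
  rw [F.inner_spatial hg]
  exact hv

theorem inv_mem_spatial {g : F.group} (hg : g ∈ F.spatial) : g⁻¹ ∈ F.spatial := by
  refine ⟨?_, ?_⟩
  · rw [← gamma_inv, hg.1]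
  · change g.1.linearIsometryEquiv.symm F.e = F.e
    rw [LinearIsometryEquiv.symm_apply_eq, hg.2]

/-- Conjugation by r_e ⊕ 1 on ℝ^d × ℝ changes the sign of the block matrix of m, because m is in the
(−1)-eigenspace. Exponentiating gives γ(g) = g⁻¹. -/
theorem gamma_inv_of_isExp {m : Space d × (Space d →L[ℝ] Space d)} (hm : m ∈ F.mSpace)
    {g : F.group} (hg : F.IsExp m g) : (F.gamma g)⁻¹ = g := by
  let ρ : (Space d × ℝ) →L[ℝ] (Space d × ℝ) :=
    (F.r.toContinuousLinearEquiv : Space d →L[ℝ] Space d).prodMap (ContinuousLinearMap.id ℝ ℝ)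
  have hρ : ∀ v s, ρ (v, s) = (F.r v, s) := fun _ _ => rfl
  have hρρ : ρ * ρ = 1 := by
    refine ContinuousLinearMap.ext fun p => ?_
    change ρ (ρ (p.1, p.2)) = (p.1, p.2)
    rw [hρ, hρ, r_r]
  let _ : NormedAlgebra ℚ ((Space d × ℝ) →L[ℝ] (Space d × ℝ)) :=
    NormedAlgebra.restrictScalars ℚ ℝ _
  let u : ((Space d × ℝ) →L[ℝ] (Space d × ℝ))ˣ := ⟨ρ, ρ, hρρ, hρρ⟩
  have hconj : ρ * blockMatrix m * ρ = -blockMatrix m := by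
    refine ContinuousLinearMap.ext fun p => ?_
    have h1 : ∀ q : Space d × ℝ, blockMatrix m q = (m.2 q.1 + q.2 • m.1, 0) := fun q => rfl
    change ρ (blockMatrix m (ρ (p.1, p.2))) = -blockMatrix m p
    rw [h1, h1, hρ, hρ]
    simp only [map_add, map_smul, hm.2.1, hm.2.2, smul_neg]
    refine Prod.ext ?_ (by simp)
    simp only [Prod.fst_neg]
    abel
  have hexp : NormedSpace.exp (-blockMatrix m) = ρ * NormedSpace.exp (blockMatrix m) * ρ := by
    rw [← hconj]
    exact NormedSpace.exp_units_conj u (blockMatrix m)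
  have hinv : NormedSpace.exp (-blockMatrix m) * NormedSpace.exp (blockMatrix m) = 1 := by
    have h := NormedSpace.exp_add_of_commute (Commute.refl (blockMatrix m)).neg_left
    rw [neg_add_cancel, NormedSpace.exp_zero] at h
    exact h.symm
  rw [inv_eq_iff_mul_eq_one]
  refine F.group_ext fun v => ?_
  have h1 := congrArg (fun A => A (v, (1 : ℝ))) hinv
  have h2 : NormedSpace.exp (-blockMatrix m) (NormedSpace.exp (blockMatrix m) (v, (1 : ℝ))) =
      (v, (1 : ℝ)) := h1
  rw [hg v, hexp] at h2
  change ρ (NormedSpace.exp (blockMatrix m) (ρ (g.1 v, 1))) = _ at h2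
  rw [hρ (g.1 v) 1, hg, hρ] at h2
  exact congrArg Prod.fst h2

end Frame

/-- Expand ‖ψ − f x‖²: the two limits make it tend to ‖ψ‖² + ‖ψ‖² − 2‖ψ‖² = 0. This reduces strong
continuity to continuity of matrix elements. -/
theorem tendsto_of_tendsto_inner {H X : Type*} [NormedAddCommGroup H] [InnerProductSpace ℂ H]
    {l : Filter X} {f : X → H} {ψ : H}
    (h₁ : Tendsto (fun x => ⟪f x, f x⟫_ℂ) l (𝓝 ⟪ψ, ψ⟫_ℂ))
    (h₂ : Tendsto (fun x => ⟪ψ, f x⟫_ℂ) l (𝓝 ⟪ψ, ψ⟫_ℂ)) : Tendsto f l (𝓝 ψ) := by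
  rw [tendsto_iff_norm_sub_tendsto_zero]
  have h : Tendsto (fun x => ‖ψ - f x‖ ^ 2) l (𝓝 0) := by
    have h₃ := ((Complex.continuous_re.tendsto _).comp h₁).add
      (((Complex.continuous_re.tendsto _).comp h₂).const_mul (-2))
    have h₄ := h₃.const_add (⟪ψ, ψ⟫_ℂ).re
    have h₅ : (⟪ψ, ψ⟫_ℂ).re + ((⟪ψ, ψ⟫_ℂ).re + -2 * (⟪ψ, ψ⟫_ℂ).re) = 0 := by ring
    rw [h₅] at h₄
    refine h₄.congr fun x => ?_
    have n₁ := norm_sub_sq (𝕜 := ℂ) ψ (f x)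
    have n₂ := inner_self_eq_norm_sq (𝕜 := ℂ) ψ
    have n₃ := inner_self_eq_norm_sq (𝕜 := ℂ) (f x)
    simp only [RCLike.re_to_complex] at n₁ n₂ n₃
    rw [n₁, ← n₂, ← n₃]
    simp only [Function.comp_apply]
    ring
  have h' := h.sqrt
  simp only [Real.sqrt_zero, Real.sqrt_sq (norm_nonneg _)] at h'
  exact h'.congr fun x => norm_sub_rev _ _

/-- A bounded family of nonnegative numbers in which `b i ^ 2 ≤ x * b j` for every `i` and some `j`
is bounded by `x`. -/
theorem le_of_sq_le_mul {ι : Type*} {b : ι → ℝ} {x : ℝ} (hx : 0 ≤ x) (h0 : ∀ i, 0 ≤ b i)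
    (hb : BddAbove (Set.range b)) (h : ∀ i, ∃ j, b i ^ 2 ≤ x * b j) (i : ι) : b i ≤ x := by
  have : Nonempty ι := ⟨i⟩
  set M := ⨆ j, b j
  have hbM : ∀ j, b j ≤ M := fun j => le_ciSup hb j
  have hM0 : 0 ≤ M := (h0 i).trans (hbM i)
  -- Hence M² ≤ xM for the supremum M; boundedness of the family permits division by M when it is
  -- positive.
  have h1 : M ≤ √(x * M) := ciSup_le fun j => by
    obtain ⟨k, hk⟩ := h j
    exact Real.le_sqrt_of_sq_le (hk.trans (mul_le_mul_of_nonneg_left (hbM k) hx))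
  rcases hM0.eq_or_lt with h3 | h3
  · exact (hbM i).trans (h3 ▸ hx)
  · refine (hbM i).trans (le_of_mul_le_mul_right ?_ h3)
    rw [← sq]
    exact (Real.le_sqrt' h3).1 h1

/-! ### Local algebras and their translations -/

namespace CovariantNet

variable {d : ℕ} {F : Frame d} {𝓐 : Type*} [CStarAlgebra 𝓐] (N : CovariantNet F 𝓐)

theorem α_α (g h : F.group) (A : 𝓐) : N.α g (N.α h A) = N.α (g * h) A := by
  rw [map_mul]
  rfl

theorem α_one (A : 𝓐) : N.α 1 A = A := by
  rw [map_one]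
  rfl

/-- The local algebras of the regions in `X` are directed, so that they have as union the
*-algebra that they generate. -/
theorem exists_region_of_mem_iSup {X : Set (Space d)} {A : 𝓐}
    (hA : A ∈ ⨆ O : {O : Region d // O.1 ⊆ X}, N.alg O.1) :
    ∃ O : Region d, O.1 ⊆ X ∧ A ∈ N.alg O := by
  -- Scalars belong to every local algebra, so the empty region, contained in every X, can carry
  -- them.
  let E : Region d := ⟨∅, isOpen_empty, Bornology.isBounded_empty⟩
  let sup : Region d → Region d → Region d := fun O P =>
    ⟨O.1 ∪ P.1, O.2.1.union P.2.1, O.2.2.union P.2.2⟩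
  have hl : ∀ {O P A}, A ∈ N.alg O → A ∈ N.alg (sup O P) := fun {O P _} h =>
    N.isotony O (sup O P) Set.subset_union_left h
  have hr : ∀ {O P A}, A ∈ N.alg P → A ∈ N.alg (sup O P) := fun {O P _} h =>
    N.isotony P (sup O P) Set.subset_union_right h
  let K : StarSubalgebra ℂ 𝓐 :=
    { carrier := {A | ∃ O : Region d, O.1 ⊆ X ∧ A ∈ N.alg O}
      mul_mem' := by
        rintro A B ⟨O, hO, hA⟩ ⟨P, hP, hB⟩
        exact ⟨sup O P, Set.union_subset hO hP, mul_mem (hl hA) (hr hB)⟩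
      add_mem' := by
        rintro A B ⟨O, hO, hA⟩ ⟨P, hP, hB⟩
        exact ⟨sup O P, Set.union_subset hO hP, add_mem (hl hA) (hr hB)⟩
      algebraMap_mem' := fun c => ⟨E, Set.empty_subset X, algebraMap_mem _ c⟩
      star_mem' := by
        rintro A ⟨O, hO, hA⟩
        exact ⟨O, hO, star_mem hA⟩ }
  have hK : (⨆ O : {O : Region d // O.1 ⊆ X}, N.alg O.1) ≤ K :=
    iSup_le fun O A hA => ⟨O.1, O.2, hA⟩
  exact hK hA

theorem mem_algOn_of_mem_alg {X : Set (Space d)} {O : Region d} (hO : O.1 ⊆ X) {A : 𝓐}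
    (hA : A ∈ N.alg O) : A ∈ N.algOn X :=
  StarSubalgebra.le_topologicalClosure _
    (le_iSup (fun O : {O : Region d // O.1 ⊆ X} => N.alg O.1) ⟨O, hO⟩ hA)

theorem mem_algOn_self {O : Region d} {A : 𝓐} (hA : A ∈ N.alg O) : A ∈ N.algOn O.1 :=
  N.mem_algOn_of_mem_alg subset_rfl hA

theorem mem_preDomain {g : F.group} {O : Set (Space d)} (hO : IsOpen O) (h : O ⊆ F.halfSpace)
    (hg : F.act g O ⊆ F.halfSpace) (hγ : F.act ((F.gamma g)⁻¹ * g) O ⊆ F.halfSpace) {A : 𝓐}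
    (hA : A ∈ N.algOn O) : A ∈ N.preDomain g :=
  le_iSup (fun O : {O : Set (Space d) // IsOpen O ∧ O ⊆ F.halfSpace ∧ F.act g O ⊆ F.halfSpace ∧
      F.act ((F.gamma g)⁻¹ * g) O ⊆ F.halfSpace} =>
    Subalgebra.toSubmodule (N.algOn O.1).toSubalgebra) ⟨O, hO, h, hg, hγ⟩ hA

/-- The action on `𝓔_>` of an element of `E_θ(d)` that preserves the half space. -/
def posMap (g : F.group) (hg : F.act g F.halfSpace ⊆ F.halfSpace) : N.pos →ₗ[ℂ] N.pos where
  toFun A := ⟨N.α g A, N.α_mem g hg A.2⟩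
  map_add' _ _ := Subtype.ext (map_add (N.α g) _ _)
  map_smul' c _ := Subtype.ext (map_smul (N.α g) c _)

/-- The translation of `𝓔_>` by `t e`. -/
def shift (t : ℝ≥0) : N.pos →ₗ[ℂ] N.pos :=
  N.posMap (F.timeTranslation t) (F.act_timeTranslation_halfSpace t.coe_nonneg)

theorem coe_shift (t : ℝ≥0) (A : N.pos) :
    (N.shift t A : 𝓐) = N.α (F.timeTranslation t) A := rfl

theorem shift_zero (A : N.pos) : N.shift 0 A = A := by
  refine Subtype.ext ?_
  rw [coe_shift, NNReal.coe_zero, F.timeTranslation_zero, α_one]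

theorem shift_add (s t : ℝ≥0) (A : N.pos) : N.shift (s + t) A = N.shift s (N.shift t A) := by
  refine Subtype.ext ?_
  rw [coe_shift, coe_shift, coe_shift, NNReal.coe_add, F.timeTranslation_add, α_α]

end CovariantNet

/-! ### Hilbert space operators from reflection positivity -/

namespace ReflectionPositiveFunctional

variable {d : ℕ} {F : Frame d} {𝓐 : Type*} [CStarAlgebra 𝓐] {N : CovariantNet F 𝓐}
  (S : ReflectionPositiveFunctional N)

theorem ι_ι (A : 𝓐) : S.ι (S.ι A) = A := by
  have h := S.ι_α_ι 1 A
  rwa [F.gamma_one, N.α_one, N.α_one] at h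

theorem ι_α (g : F.group) (A : 𝓐) : S.ι (N.α g A) = N.α (F.gamma g) (S.ι A) := by
  rw [← S.ι_α_ι, ι_ι]

/-- Move α_g through `ι`, where it becomes α_{γ(g)}, and apply the invariance of `σ` under γ(g)⁻¹.
-/
theorem form_α_left (g : F.group) (A B : 𝓐) :
    S.σ (S.ι (star (N.α g A)) * B) = S.σ (S.ι (star A) * N.α (F.gamma g)⁻¹ B) := by
  rw [← map_star (N.α g), ι_α, ← S.invariant (F.gamma g)⁻¹, map_mul, N.α_α, inv_mul_cancel,
    N.α_one]

theorem denseRange_cls : DenseRange S.cls :=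
  UniformSpace.Completion.denseRange_coe (α := S.PreHilbert)

theorem norm_cls_sq_le (A : N.pos) : ‖S.cls A‖ ^ 2 ≤ ‖S.σ‖ * ‖A‖ ^ 2 := by
  have h1 : ‖S.ι (star (A : 𝓐))‖ = ‖A‖ := by
    rw [(StarAlgEquiv.isometry S.ι).norm_map_of_map_zero (map_zero S.ι), norm_star]
    rfl
  calc ‖S.cls A‖ ^ 2 = ‖⟪S.cls A, S.cls A⟫_ℂ‖ := by
        rw [inner_self_eq_norm_sq_to_K]
        simp
    _ ≤ ‖S.σ‖ * ‖S.ι (star (A : 𝓐)) * (A : 𝓐)‖ := by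
        rw [inner_cls]
        exact S.σ.le_opNorm _
    _ ≤ ‖S.σ‖ * (‖A‖ * ‖A‖) := by
        gcongr
        refine (norm_mul_le _ _).trans_eq ?_
        rw [h1]
        rfl
    _ = _ := by rw [sq]

theorem norm_cls_le (A : N.pos) : ‖S.cls A‖ ≤ √‖S.σ‖ * ‖A‖ := by
  refine abs_le_of_sq_le_sq' ?_ (by positivity) |>.2
  rw [mul_pow, Real.sq_sqrt (norm_nonneg _)]
  exact S.norm_cls_sq_le A

theorem continuous_cls : Continuous S.cls :=
  AddMonoidHomClass.continuous_of_bound S.cls _ S.norm_cls_le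

/-! ### The operators `V(g)` -/

theorem cls_mem_domain {g : F.group} {A B : N.pos} (hA : (A : 𝓐) ∈ N.preDomain g)
    (hB : (B : 𝓐) = N.α g A) : S.cls A ∈ (S.V g).domain := by
  refine LinearPMap.mem_domain_iff.2 ⟨S.cls B, ?_⟩
  rw [graph_V]
  exact ⟨A, B, hA, hB, rfl⟩

theorem V_cls {g : F.group} {A B : N.pos} (hA : (A : 𝓐) ∈ N.preDomain g)
    (hB : (B : 𝓐) = N.α g A) (h : S.cls A ∈ (S.V g).domain) : S.V g ⟨S.cls A, h⟩ = S.cls B := by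
  have h1 : (S.cls A, S.cls B) ∈ (S.V g).graph := by
    rw [graph_V]
    exact ⟨A, B, hA, hB, rfl⟩
  exact (S.V g).mem_graph_snd_inj ((S.V g).mem_graph ⟨S.cls A, h⟩) h1 rfl

theorem exists_of_mem_domain {g : F.group} (ψ : (S.V g).domain) :
    ∃ A B : N.pos, (A : 𝓐) ∈ N.preDomain g ∧ (B : 𝓐) = N.α g A ∧
      (ψ : S.Hilbert) = S.cls A ∧ S.V g ψ = S.cls B := by
  have h := (S.V g).mem_graph ψ
  rw [graph_V] at h
  obtain ⟨A, B, hA, hB, h⟩ := h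
  exact ⟨A, B, hA, hB, congrArg Prod.fst h, congrArg Prod.snd h⟩

/-! ### The time evolution -/

/-- Time translations satisfy γ(g)⁻¹ = g, so the left shift reappears on the right and the two times
add. -/
theorem inner_shift_shift (s t : ℝ≥0) (A B : N.pos) :
    ⟪S.cls (N.shift s A), S.cls (N.shift t B)⟫_ℂ = ⟪S.cls A, S.cls (N.shift (s + t) B)⟫_ℂ := by
  rw [inner_cls, inner_cls, N.coe_shift, N.coe_shift, N.coe_shift, form_α_left,
    F.gamma_timeTranslation_inv, N.α_α, NNReal.coe_add, F.timeTranslation_add]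

theorem norm_cls_shift_le (t : ℝ≥0) (A : N.pos) : ‖S.cls (N.shift t A)‖ ≤ ‖S.cls A‖ := by
  -- The orbit is bounded because `α` preserves the C*-norm; t + t is the doubled time produced by
  -- the Cauchy–Schwarz inequality.
  refine le_of_sq_le_mul (b := fun t => ‖S.cls (N.shift t A)‖) (norm_nonneg _)
    (fun _ => norm_nonneg _) ⟨√‖S.σ‖ * ‖A‖, ?_⟩ (fun t => ⟨t + t, ?_⟩) t
  · rintro _ ⟨t, rfl⟩
    refine (S.norm_cls_le _).trans_eq ?_
    congr 1
    exact (StarAlgEquiv.isometry (N.α (F.timeTranslation t))).norm_map_of_map_zero (map_zero _) _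
  · calc ‖S.cls (N.shift t A)‖ ^ 2 = ‖⟪S.cls (N.shift t A), S.cls (N.shift t A)⟫_ℂ‖ := by
          rw [inner_self_eq_norm_sq_to_K]
          simp
      _ ≤ _ := by
          rw [inner_shift_shift]
          exact norm_inner_le_norm _ _

/-- The contraction semigroup that extends the translations in the direction `e`. -/
def evolution (t : ℝ≥0) : S.Hilbert →L[ℂ] S.Hilbert := (S.cls ∘ₗ N.shift t).extendOfNorm S.cls

theorem evolution_cls (t : ℝ≥0) (A : N.pos) : S.evolution t (S.cls A) = S.cls (N.shift t A) :=
  LinearMap.extendOfNorm_eq S.denseRange_cls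
    ⟨1, fun A => by simpa using S.norm_cls_shift_le t A⟩ A

theorem norm_evolution_le (t : ℝ≥0) : ‖S.evolution t‖ ≤ 1 :=
  LinearMap.opNorm_extendOfNorm_le S.denseRange_cls zero_le_one fun A => by
    simpa using S.norm_cls_shift_le t A

theorem clm_ext {T T' : S.Hilbert →L[ℂ] S.Hilbert} (h : ∀ A, T (S.cls A) = T' (S.cls A)) :
    T = T' :=
  DFunLike.coe_injective (S.denseRange_cls.equalizer T.continuous T'.continuous (funext h))

theorem continuous_evolution_cls (A : N.pos) : Continuous fun t => S.evolution t (S.cls A) := by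
  have hc : Continuous fun t : ℝ≥0 => ⟪S.cls A, S.cls (N.shift t A)⟫_ℂ := by
    simp only [inner_cls, N.coe_shift]
    exact (S.continuous_σ _ _).comp (F.continuous_timeTranslation.comp NNReal.continuous_coe)
  rw [continuous_iff_continuousAt]
  intro s
  simp only [ContinuousAt, evolution_cls]
  refine tendsto_of_tendsto_inner ?_ ?_
  · simp only [inner_shift_shift]
    exact (hc.comp (continuous_id.add continuous_id)).tendsto s
  · simp only [inner_shift_shift]
    exact (hc.comp (continuous_const.add continuous_id)).tendsto s

theorem isContractionSemigroup_evolution : IsContractionSemigroup S.evolution where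
  zero := S.clm_ext fun A => by
    rw [evolution_cls, N.shift_zero]
    rfl
  add s t := S.clm_ext fun A => by
    rw [evolution_cls, N.shift_add, ← evolution_cls, ← evolution_cls]
    rfl
  norm_le := S.norm_evolution_le
  continuous ψ := by
    refine continuous_of_uniform_approx_of_continuous fun u hu => ?_
    obtain ⟨ε, hε, h⟩ := Metric.mem_uniformity_dist.1 hu
    obtain ⟨A, hA⟩ := S.denseRange_cls.exists_dist_lt ψ hε
    refine ⟨_, S.continuous_evolution_cls A, fun t => h ?_⟩
    rw [dist_eq_norm] at hA
    rw [dist_eq_norm, ← map_sub]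
    refine lt_of_le_of_lt ?_ hA
    simpa using (S.evolution t).le_of_opNorm_le (S.norm_evolution_le t) (ψ - S.cls A)

theorem evolution_symm (t : ℝ≥0) (ψ φ : S.Hilbert) :
    ⟪S.evolution t ψ, φ⟫_ℂ = ⟪ψ, S.evolution t φ⟫_ℂ := by
  refine S.denseRange_cls.induction_on₂ (p := fun ψ φ =>
    ⟪S.evolution t ψ, φ⟫_ℂ = ⟪ψ, S.evolution t φ⟫_ℂ) ?_ (fun A B => ?_) ψ φ
  · exact isClosed_eq (by fun_prop) (by fun_prop)
  · have h := S.inner_shift_shift t 0 A B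
    rwa [N.shift_zero, add_zero, ← evolution_cls, ← evolution_cls] at h

theorem mem_preDomain_timeTranslation (t : ℝ≥0) (A : N.pos) :
    (A : 𝓐) ∈ N.preDomain (F.timeTranslation t) := by
  have h := F.act_timeTranslation_halfSpace t.coe_nonneg
  refine N.mem_preDomain F.isOpen_halfSpace subset_rfl h ?_ A.2
  -- Here γ(g)⁻¹g is the translation applied twice, so the whole half space is an allowed region.
  rw [F.gamma_timeTranslation_inv, F.act_mul]
  exact (Set.image_mono h).trans h

theorem domain_V_timeTranslation (t : ℝ≥0) : (S.V (F.timeTranslation t)).domain = S.D := by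
  ext ψ
  constructor
  · intro h
    obtain ⟨A, B, -, -, h, -⟩ := S.exists_of_mem_domain ⟨ψ, h⟩
    exact ⟨A, h.symm⟩
  · rintro ⟨A, rfl⟩
    exact S.cls_mem_domain (mem_preDomain_timeTranslation t A) (N.coe_shift t A)

theorem V_timeTranslation (t : ℝ≥0) (ψ : (S.V (F.timeTranslation t)).domain) :
    S.V (F.timeTranslation t) ψ = S.evolution t ψ := by
  obtain ⟨A, B, -, hB, h, h'⟩ := S.exists_of_mem_domain ψ
  rw [h, h', evolution_cls]
  congr 1
  exact Subtype.ext hB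

/-! ### Density of `𝓓₀` -/

theorem cls_mem_closure_D₀_of_mem_alg {O : Region d} {A : N.pos} (hA : (A : 𝓐) ∈ N.alg O) :
    S.cls A ∈ S.D₀.topologicalClosure := by
  obtain ⟨t, ht⟩ := F.exists_act_timeTranslation_subset_cone O.2.2
  refine Submodule.topologicalClosure_mono (Submodule.span_le.2 ?_)
    (S.isContractionSemigroup_evolution.mem_closure_span_orbit S.evolution_symm t (S.cls A))
  rintro _ ⟨s, hs, rfl⟩
  rw [evolution_cls]
  exact ⟨N.shift s A, N.α_mem _ (ht s hs) (N.mem_algOn_self hA), rfl⟩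

theorem dense_D₀ : Dense (S.D₀ : Set S.Hilbert) := by
  have key : ∀ A : N.pos, S.cls A ∈ closure (S.D₀ : Set S.Hilbert) := fun A => by
    -- Approximate A in norm by elements of single bounded regions; `cls` is continuous for the
    -- C*-norm.
    obtain ⟨u, hu, hlim⟩ := mem_closure_iff_seq_limit.1
      (show (A : 𝓐) ∈ closure ((⨆ O : {O : Region d // O.1 ⊆ F.halfSpace}, N.alg O.1 :
        StarSubalgebra ℂ 𝓐) : Set 𝓐) from A.2)
    choose O hO huO using fun n => N.exists_region_of_mem_iSup (hu n)
    let w : ℕ → N.pos := fun n => ⟨u n, N.mem_algOn_of_mem_alg (hO n) (huO n)⟩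
    have hw : Tendsto w atTop (𝓝 A) := tendsto_subtype_rng.2 hlim
    exact isClosed_closure.mem_of_tendsto ((S.continuous_cls.tendsto A).comp hw)
      (Eventually.of_forall fun n => S.cls_mem_closure_D₀_of_mem_alg (A := w n) (huO n))
  rw [← dense_closure]
  exact S.denseRange_cls.mono (Set.range_subset_iff.2 key)

/-! ### Spatial transformations -/

/-- The action of a spatial transformation on `𝓔_>`. -/
def spatialEquiv (N : CovariantNet F 𝓐) {g : F.group} (hg : g ∈ F.spatial) :
    N.pos ≃ₗ[ℂ] N.pos :=
  { N.posMap g (F.act_spatial_halfSpace hg) with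
    invFun := N.posMap g⁻¹ (F.act_spatial_halfSpace (F.inv_mem_spatial hg))
    left_inv := fun A => Subtype.ext <| by
      change N.α g⁻¹ (N.α g A) = A
      rw [N.α_α, inv_mul_cancel, N.α_one]
    right_inv := fun A => Subtype.ext <| by
      change N.α g (N.α g⁻¹ A) = A
      rw [N.α_α, mul_inv_cancel, N.α_one] }

theorem coe_spatialEquiv {g : F.group} (hg : g ∈ F.spatial) (A : N.pos) :
    (spatialEquiv N hg A : 𝓐) = N.α g A := rfl

theorem norm_cls_spatialEquiv {g : F.group} (hg : g ∈ F.spatial) (A : N.pos) :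
    ‖S.cls (spatialEquiv N hg A)‖ = ‖S.cls A‖ := by
  rw [@norm_eq_sqrt_re_inner ℂ, @norm_eq_sqrt_re_inner ℂ, inner_cls, inner_cls,
    coe_spatialEquiv, form_α_left, N.α_α, hg.1, inv_mul_cancel, N.α_one]

/-- The unitary operator of a spatial transformation. -/
def spatialUnitary {g : F.group} (hg : g ∈ F.spatial) : S.Hilbert ≃ₗᵢ[ℂ] S.Hilbert :=
  (spatialEquiv N hg).extendOfIsometry S.cls S.cls S.denseRange_cls S.denseRange_cls
    (S.norm_cls_spatialEquiv hg)

theorem V_spatial {g : F.group} (hg : g ∈ F.spatial) (ψ : (S.V g).domain) :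
    S.V g ψ = S.spatialUnitary hg ψ := by
  obtain ⟨A, B, -, hB, h, h'⟩ := S.exists_of_mem_domain ψ
  rw [h, h', spatialUnitary, LinearEquiv.extendOfIsometry_eq]
  congr 1
  exact Subtype.ext hB

/-! ### The virtual representation -/

theorem isFormalAdjoint_V {g : F.group} (hg : (F.gamma g)⁻¹ = g) :
    (S.V g).IsFormalAdjoint (S.V g) := by
  intro ψ φ
  obtain ⟨A, B, -, hB, h, h'⟩ := S.exists_of_mem_domain ψ
  obtain ⟨A', B', -, hB', k, k'⟩ := S.exists_of_mem_domain φ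
  rw [h, h', k, k', inner_cls, inner_cls, hB, hB', form_α_left, hg]

variable {U : Set F.group} (hU : F.IsAdmissible U)
include hU

theorem mem_preDomain_of_mem_cone {g : F.group} (hg : g ∈ U) {A : 𝓐} (hA : A ∈ N.algOn F.cone) :
    A ∈ N.preDomain g :=
  N.mem_preDomain F.isOpen_cone F.cone_subset_halfSpace (hU.act_cone g hg)
    (hU.act_cone_gamma g hg) hA

theorem D₀_le_domain {g : F.group} (hg : g ∈ U) : S.D₀ ≤ (S.V g).domain := by
  rintro _ ⟨A, hA, rfl⟩
  exact S.cls_mem_domain (B := ⟨_, N.α_mem g (hU.act_cone g hg) hA⟩)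
    (mem_preDomain_of_mem_cone hU hg hA) rfl

theorem V_mul {g₁ g₂ : F.group} (h₁ : g₁ ∈ U) (h₂ : g₂ ∈ U) (h₁₂ : g₁ * g₂ ∈ U) {Ψ : S.Hilbert}
    (hΨ : Ψ ∈ S.D₀) :
    ∃ h : S.V g₂ ⟨Ψ, S.D₀_le_domain hU h₂ hΨ⟩ ∈ (S.V g₁).domain,
      S.V g₁ ⟨S.V g₂ ⟨Ψ, S.D₀_le_domain hU h₂ hΨ⟩, h⟩ =
        S.V (g₁ * g₂) ⟨Ψ, S.D₀_le_domain hU h₁₂ hΨ⟩ := by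
  obtain ⟨A, hA, rfl⟩ := hΨ
  let B : N.pos := ⟨N.α g₂ A, N.α_mem g₂ (hU.act_cone g₂ h₂) hA⟩
  let C : N.pos := ⟨N.α (g₁ * g₂) A, N.α_mem _ (hU.act_cone _ h₁₂) hA⟩
  have hC : (C : 𝓐) = N.α g₁ B := (N.α_α g₁ g₂ A).symm
  have hB : (B : 𝓐) ∈ N.preDomain g₁ := by
    -- The localization region is g₂C; its images under g₁ and γ(g₁)⁻¹g₁ lie in the half space by
    -- admissibility.
    refine N.mem_preDomain (F.isOpen_act g₂ F.isOpen_cone) (hU.act_cone g₂ h₂) ?_ ?_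
      (N.α_mem g₂ subset_rfl hA)
    · rw [← F.act_mul]
      exact hU.act_cone _ h₁₂
    · rw [← F.act_mul]
      exact hU.act_cone_mul g₁ h₁ g₂ h₂ h₁₂
  have e₂ := S.V_cls (B := B) (mem_preDomain_of_mem_cone hU h₂ hA) rfl
    (S.D₀_le_domain hU h₂ ⟨A, hA, rfl⟩)
  have e₁₂ := S.V_cls (B := C) (mem_preDomain_of_mem_cone hU h₁₂ hA) rfl
    (S.D₀_le_domain hU h₁₂ ⟨A, hA, rfl⟩)
  rw [e₁₂]
  simp only [e₂]
  exact ⟨S.cls_mem_domain hB hC, S.V_cls hB hC _⟩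

theorem tendsto_V_one {Ψ : S.Hilbert} (hΨ : Ψ ∈ S.D₀) :
    Tendsto (fun g : U => S.V g.1 ⟨Ψ, S.D₀_le_domain hU g.2 hΨ⟩)
      (comap Subtype.val (𝓝 (1 : F.group))) (𝓝 Ψ) := by
  obtain ⟨A, hA, rfl⟩ := hΨ
  let B : U → N.pos := fun g => ⟨N.α g.1 A, N.α_mem g.1 (hU.act_cone g.1 g.2) hA⟩
  have hV : ∀ g : U, S.V g.1 ⟨S.cls A, S.D₀_le_domain hU g.2 ⟨A, hA, rfl⟩⟩ = S.cls (B g) :=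
    fun g => S.V_cls (mem_preDomain_of_mem_cone hU g.2 hA) rfl _
  simp only [hV]
  have hc := S.continuous_σ (S.ι (star (A : 𝓐))) A
  refine tendsto_of_tendsto_inner ?_ ?_
  -- The squared norm of V(g)[A] is σ(ι(A*) α_{γ(g)⁻¹g} A), and γ(g)⁻¹g tends to 1 with g.
  · have h := ((hc.comp F.continuous_gamma_inv_mul).tendsto 1).comp
      (tendsto_comap (f := (Subtype.val : U → F.group)))
    simp only [Function.comp_apply, F.gamma_one, inv_one, mul_one, N.α_one] at h
    rw [inner_cls]
    refine h.congr fun g => ?_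
    rw [inner_cls, form_α_left, N.α_α]
    rfl
  · have h := (hc.tendsto 1).comp (tendsto_comap (f := (Subtype.val : U → F.group)))
    rw [N.α_one] at h
    rw [inner_cls]
    refine h.congr fun g => ?_
    rw [inner_cls]
    rfl

theorem isVirtualRepresentation : IsVirtualRepresentation S U where
  dense := S.dense_D₀
  le_domain _ hg := S.D₀_le_domain hU hg
  mul _ h₁ _ h₂ h₁₂ _ hΨ := S.V_mul hU h₁ h₂ h₁₂ hΨ
  unitary _ hg := ⟨S.spatialUnitary hg, S.V_spatial hg⟩
  hermitian _ hm _ _ hg := S.isFormalAdjoint_V (F.gamma_inv_of_isExp hm hg)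
  continuous_one _ hΨ := S.tendsto_V_one hU hΨ
  contraction :=
    have hT := S.isContractionSemigroup_evolution
    ⟨S.evolution, negGenerator S.evolution, hT, hT.isSelfAdjoint_negGenerator S.evolution_symm,
      hT.negGenerator_nonneg S.evolution_symm, isExpNeg_negGenerator _,
      fun t => ⟨S.domain_V_timeTranslation t, S.V_timeTranslation t⟩⟩

end ReflectionPositiveFunctional

end EuclideanNets

end

theorem mainTheorem4 {d : ℕ} (F : EuclideanNets.Frame d) {𝓐 : Type*} [CStarAlgebra 𝓐]
    (N : EuclideanNets.CovariantNet F 𝓐) (S : EuclideanNets.ReflectionPositiveFunctional N) :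
    (∃ U : Set F.group, F.IsAdmissible U) ∧
      ∀ U : Set F.group, F.IsAdmissible U → EuclideanNets.IsVirtualRepresentation S U := by
  exact ⟨⟨F.smallSet, F.isAdmissible_smallSet⟩, fun _ hU => S.isVirtualRepresentation hU⟩
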